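/- Let $r\ge 1$ and $n\ge 0$ be integers, $\zeta=e^{2\pi i/r}$, let $q$ be an indeterminate and $\mathcal R=\mathbb Z[\tfrac1r][q,q^{-1},\zeta]$. The Yokonuma–Hecke algebra $Y_{r,n}$ is the associative unital $\mathcal R$-algebra with generators $t_1,\dots,t_n,g_1,\dots,g_{n-1}$ and relations $g_ig_j=g_jg_i$ for $|i-j|\ge 2$, $g_ig_{i+1}g_i=g_{i+1}g_ig_{i+1}$, $t_it_j=t_jt_i$, $g_it_j=t_{s_i(j)}g_i$ with $s_i=(i,i+1)$, $t_i^r=1$, and $g_i^2=1+(q-q^{-1})e_{i,i+1}g_i$, where $e_{i,k}=\frac1r\sum_{s=0}^{r-1}t_i^st_k^{-s}$. Let $l$ be the length function on $\mathfrak S_n$ with respect to $s_1,\dots,s_{n-1}$, and for $w\in\mathfrak S_n$ with reduced expression $w=s_{i_1}\cdots s_{i_k}$ put $g_w=g_{i_1}\cdots g_{i_k}$ (this does not depend on the reduced expression). Fix an enumeration $\zeta_1,\dots,\zeta_r$ of the $r$-th roots of unity $\zeta^0,\dots,\zeta^{r-1}$. An $r$-composition of $n$ is an $r$-tuple $\mu=(\mu^{(1)},\dots,\mu^{(r)})$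 of finite sequences of nonnegative integers with total sum $n$; its type is $\alpha(\mu)=(|\mu^{(1)}|,\dots,|\mu^{(r)}|)$, where $|\mu^{(k)}|$ is the sum of the entries of $\mu^{(k)}$. Let $\mathfrak S_\mu\subseteq\mathfrak S_n$ be the Young subgroup preserving each of the consecutive intervals of $\{1,\dots,n\}$ whose lengths are the entries of $\mu^{(1)}$, then those of $\mu^{(2)}$, and so on; for $\alpha=\alpha(\mu)$ let $\mathfrak S_\alpha$ be the Young subgroup preserving each of the consecutive intervals $I_1,\dots,I_r$ of lengths $|\mu^{(1)}|,\dots,|\mu^{(r)}|$. Let $a_k=|\mu^{(1)}|+\dots+|\mu^{(k)}|$ and put $$U_\mu=\prod_{k:\,|\mu^{(k)}|\neq0}\ \prod_{l\ne k}(t_{a_k}-\zeta_l)\ \cdot\prod_{k:\,|\mu^{(k)}|\neq0}\ \prod_{i<j,\ i,j\in I_k}e_{i,j},\qquad m_\mu=U_\mu\sum_{w\in\mathfrak S_\mu}q^{l(w)}g_w,$$ and let $M^\mu=m_\mu Y_{r,n}$, a right $Y_{r,n}$-module. Let $\mathcal D_\mu=\{d\in\mathfrak S_n : l(wd)=l(w)+l(d)\text{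 for all }w\in\mathfrak S_\mu\}$ and $\mathcal D_{\mu\nu}=\mathcal D_\mu\cap\mathcal D_\nu^{-1}$. Let $\mu,\nu$ be $r$-compositions of $n$, and let $\mathrm{Hom}_{Y_{r,n}}(M^\nu,M^\mu)$ be the $\mathcal R$-module of homomorphisms of right $Y_{r,n}$-modules. (i) If $\alpha(\mu)\ne\alpha(\nu)$, then $\mathrm{Hom}_{Y_{r,n}}(M^\nu,M^\mu)=0$. (ii) If $\alpha(\mu)=\alpha(\nu)=\alpha$, then for every $d\in\mathcal D_{\mu\nu}\cap\mathfrak S_\alpha$ there is a (unique) homomorphism $\varphi^d_{\mu\nu}\in\mathrm{Hom}_{Y_{r,n}}(M^\nu,M^\mu)$ with $$\varphi^d_{\mu\nu}(m_\nu h)=\sum_{w\in\mathfrak S_\mu d\,\mathfrak S_\nu}q^{l(w)}U_\mu g_wh\qquad\text{for all }h\in Y_{r,n},$$ and $\mathrm{Hom}_{Y_{r,n}}(M^\nu,M^\mu)$ is a free $\mathcal R$-module with basis $\{\varphi^d_{\mu\nu} : d\in\mathcal D_{\mu\nu}\cap\mathfrak S_\alpha\}$. -/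

import Mathlib

noncomputable section

namespace YokonumaSchur

/-! ### The ground ring `ℤ[1/r][q, q⁻¹, ζ]` with `ζ = exp (2πi/r)` -/

/-- The complex number `ζ = exp (2πi/r)`. -/
def zetaC (r : ℕ) : ℂ := Complex.exp (2 * Real.pi * Complex.I / r)

/-- The subring `ℤ[1/r, ζ]` of `ℂ`. -/
abbrev Coeff (r : ℕ) : Type := Algebra.adjoin ℤ ({(r : ℂ)⁻¹, zetaC r} : Set ℂ)

/-- The ring `ℤ[1/r][q, q⁻¹, ζ]`: Laurent polynomials in the indeterminate `q`. -/
def Base (r : ℕ) : Type := LaurentPolynomial (Coeff r)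

instance (r : ℕ) : CommRing (Base r) := inferInstanceAs (CommRing (LaurentPolynomial (Coeff r)))

/-- `1/r`, as an element of the ground ring. -/
def invr (r : ℕ) : Base r :=
  LaurentPolynomial.C (R := Coeff r) ⟨(r : ℂ)⁻¹, Algebra.subset_adjoin (by simp)⟩

/-- `ζ`, as an element of the ground ring. -/
def zeta (r : ℕ) : Base r :=
  LaurentPolynomial.C (R := Coeff r) ⟨zetaC r, Algebra.subset_adjoin (by simp)⟩

/-- The indeterminate `q`. -/
def q (r : ℕ) : Base r := (LaurentPolynomial.T 1 : LaurentPolynomial (Coeff r))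

/-- The inverse `q⁻¹` of the indeterminate. -/
def qinv (r : ℕ) : Base r := (LaurentPolynomial.T (-1) : LaurentPolynomial (Coeff r))

/-! ### The symmetric group

Letters are numbered `0, …, n - 1` and simple transpositions `0, …, n - 2`. -/

/-- The smaller letter moved by the `i`-th simple transposition. -/
def lo {n : ℕ} (i : Fin (n - 1)) : Fin n := ⟨i, by omega⟩

/-- The larger letter moved by the `i`-th simple transposition. -/
def hi {n : ℕ} (i : Fin (n - 1)) : Fin n := ⟨i + 1, by omega⟩

/-- The simple transposition `s_i = (i, i+1)`. -/
def simple {n : ℕ} (i : Fin (n - 1)) : Equiv.Perm (Fin n) := Equiv.swap (lo i) (hi i)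

/-- The permutation `s_{i₁} ⋯ s_{iₖ}` given by a word `i₁ … iₖ`. -/
def wordProd {n : ℕ} (l : List (Fin (n - 1))) : Equiv.Perm (Fin n) := (l.map simple).prod

/-- The length of a permutation: the least length of a word in the simple transpositions. -/
def len {n : ℕ} (w : Equiv.Perm (Fin n)) : ℕ :=
  sInf {k | ∃ l : List (Fin (n - 1)), wordProd l = w ∧ l.length = k}

theorem exists_word {n : ℕ} (w : Equiv.Perm (Fin n)) :
    ∃ l : List (Fin (n - 1)), wordProd l = w := by
  cases n with
  | zero => exact ⟨[], Subsingleton.elim _ _⟩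
  | succ m =>
    have hw : w ∈ Submonoid.closure
        (Set.range fun i : Fin m => Equiv.swap i.castSucc i.succ) := by
      rw [Equiv.Perm.mclosure_swap_castSucc_succ]; trivial
    induction hw using Submonoid.closure_induction with
    | mem x hx =>
      obtain ⟨i, rfl⟩ := hx
      refine ⟨[i], ?_⟩
      simp only [wordProd, List.map_cons, List.map_nil, List.prod_cons, List.prod_nil, mul_one]
      rfl
    | one => exact ⟨[], rfl⟩
    | mul x y _ _ hx hy =>
      obtain ⟨l, rfl⟩ := hx
      obtain ⟨l', rfl⟩ := hy
      exact ⟨l ++ l', by simp [wordProd]⟩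

theorem exists_reduced_word {n : ℕ} (w : Equiv.Perm (Fin n)) :
    ∃ l : List (Fin (n - 1)), wordProd l = w ∧ l.length = len w :=
  Nat.sInf_mem (s := {k | ∃ l : List (Fin (n - 1)), wordProd l = w ∧ l.length = k})
    ((exists_word w).elim fun l hl => ⟨l.length, l, hl, rfl⟩)

/-- A reduced expression of `w`. -/
def reducedWord {n : ℕ} (w : Equiv.Perm (Fin n)) : List (Fin (n - 1)) :=
  (exists_reduced_word w).choose

/-! ### The Yokonuma-Hecke algebra -/

/-- The free algebra on `t_1, …, t_n, g_1, …, g_{n-1}`. -/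
abbrev Free (r n : ℕ) : Type := FreeAlgebra (Base r) (Fin n ⊕ Fin (n - 1))

/-- The generator `t_i` of the free algebra. -/
def ft {r n : ℕ} (i : Fin n) : Free r n := FreeAlgebra.ι _ (Sum.inl i)

/-- The generator `g_i` of the free algebra. -/
def fg {r n : ℕ} (i : Fin (n - 1)) : Free r n := FreeAlgebra.ι _ (Sum.inr i)

/-- `(1/r) ∑_{s=0}^{r-1} a^s b^{-s}` for elements with `b^r = 1`, so that `b^{-s} = b^{r-s}`. -/
def avg (r : ℕ) {A : Type} [Semiring A] [Algebra (Base r) A] (a b : A) : A :=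
  invr r • ∑ s ∈ Finset.range r, a ^ s * b ^ (r - s)

/-- The defining relations of the Yokonuma-Hecke algebra. -/
inductive Rel (r n : ℕ) : Free r n → Free r n → Prop
  | comm_g (i j : Fin (n - 1)) (h : (i : ℕ) + 2 ≤ j ∨ (j : ℕ) + 2 ≤ i) :
      Rel r n (fg i * fg j) (fg j * fg i)
  | braid (i j : Fin (n - 1)) (h : (j : ℕ) = i + 1) :
      Rel r n (fg i * fg j * fg i) (fg j * fg i * fg j)
  | comm_t (i j : Fin n) : Rel r n (ft i * ft j) (ft j * ft i)
  | g_t (i : Fin (n - 1)) (j : Fin n) : Rel r n (fg i * ft j) (ft (simple i j) * fg i)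
  | t_pow (i : Fin n) : Rel r n (ft i ^ r) 1
  | g_sq (i : Fin (n - 1)) :
      Rel r n (fg i ^ 2) (1 + (q r - qinv r) • (avg r (ft (lo i)) (ft (hi i)) * fg i))

/-- The Yokonuma-Hecke algebra `Y_{r,n}(q)`. -/
def Y (r n : ℕ) : Type := RingQuot (Rel r n)

instance (r n : ℕ) : Ring (Y r n) := inferInstanceAs (Ring (RingQuot (Rel r n)))

instance (r n : ℕ) : Algebra (Base r) (Y r n) :=
  inferInstanceAs (Algebra (Base r) (RingQuot (Rel r n)))

/-- The quotient map from the free algebra. -/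
def mk (r n : ℕ) : Free r n →ₐ[Base r] Y r n := RingQuot.mkAlgHom (Base r) (Rel r n)

/-- The generator `t_i`. -/
def t {r n : ℕ} (i : Fin n) : Y r n := mk r n (ft i)

/-- The generator `g_i`. -/
def g {r n : ℕ} (i : Fin (n - 1)) : Y r n := mk r n (fg i)

/-- The element `g_w = g_{i₁} ⋯ g_{iₖ}` for a reduced expression `w = s_{i₁} ⋯ s_{iₖ}`. -/
def gw (r : ℕ) {n : ℕ} (w : Equiv.Perm (Fin n)) : Y r n := ((reducedWord w).map g).prod

/-- The element `e_{i,k}`. -/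
def e {r n : ℕ} (i k : Fin n) : Y r n := avg r (t i) (t k)

open Classical in
/-- `E_I = ∏_{i<j in I} e_{i,j}` (the factors commute; they are listed in increasing order). -/
def EI (r : ℕ) {n : ℕ} (I : Finset (Fin n)) : Y r n :=
  ((List.finRange n).map fun i => ((List.finRange n).map fun j =>
    if i ∈ I ∧ j ∈ I ∧ i < j then (e i j : Y r n) else 1).prod).prod

/-! ### Compositions and Young subgroups -/

/-- The `k`-th of the consecutive intervals of lengths given by `L` in `{0, …, n-1}`. -/
def interval (L : List ℕ) (n k : ℕ) : Finset (Fin n) :=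
  {j | (L.take k).sum ≤ (j : ℕ) ∧ (j : ℕ) < (L.take (k + 1)).sum}

/-- The Young subgroup: the permutations preserving each interval given by `L`. -/
def young (L : List ℕ) (n : ℕ) : Subgroup (Equiv.Perm (Fin n)) where
  carrier := {w | ∀ k j, w j ∈ interval L n k ↔ j ∈ interval L n k}
  one_mem' := fun _ _ => Iff.rfl
  mul_mem' := fun {a b} ha hb k j => (ha k (b j)).trans (hb k j)
  inv_mem' := fun {a} ha k j => by simpa using (ha k (a⁻¹ j)).symm

/-- An `r`-composition of `n`: an `r`-tuple of finite sequences of nonnegative integers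
with total sum `n`. -/
structure RComp (r n : ℕ) where
  /-- The components. -/
  comp : Fin r → List ℕ
  /-- The entries add up to `n`. -/
  sum_eq : ∑ k, (comp k).sum = n

namespace RComp

variable {r n : ℕ}

/-- The type `α(μ) = (|μ^{(1)}|, …, |μ^{(r)}|)`. -/
def type (μ : RComp r n) : Fin r → ℕ := fun k => (μ.comp k).sum

/-- The type, as a list. -/
def typeList (μ : RComp r n) : List ℕ := List.ofFn μ.type

/-- The lengths of the rows of `𝔱^μ`, in the order in which `𝔱^μ` is filled. -/
def rows (μ : RComp r n) : List ℕ := (List.ofFn μ.comp).flatten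

/-- The Young subgroup `𝔖_μ`, the row stabilizer of `𝔱^μ`. -/
def S (μ : RComp r n) : Subgroup (Equiv.Perm (Fin n)) := young μ.rows n

/-- The Young subgroup `𝔖_α` for `α = α(μ)`. -/
def Sα (μ : RComp r n) : Subgroup (Equiv.Perm (Fin n)) := young μ.typeList n

/-- The distinguished right coset representatives of `𝔖_μ` in `𝔖_n`. -/
def D (μ : RComp r n) : Set (Equiv.Perm (Fin n)) :=
  {d | ∀ w ∈ μ.S, len (w * d) = len w + len d}

/-- `𝒟_{μν} = 𝒟_μ ∩ 𝒟_ν⁻¹`. -/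
def DD (μ ν : RComp r n) : Set (Equiv.Perm (Fin n)) := {d | d ∈ μ.D ∧ d⁻¹ ∈ ν.D}

theorem typeList_sum (μ : RComp r n) : μ.typeList.sum = n := by
  rw [typeList, List.sum_ofFn]; exact μ.sum_eq

theorem lastPos_lt (μ : RComp r n) (k : Fin r) (h : μ.type k ≠ 0) :
    (μ.typeList.take (k + 1)).sum - 1 < n := by
  have h1 : (μ.typeList.take (k + 1)).sum ≤ n := by
    conv_rhs => rw [← μ.typeList_sum, ← List.sum_take_add_sum_drop μ.typeList (k + 1)]
    exact Nat.le_add_right _ _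
  have h2 : μ.type k ≤ n := by
    conv_rhs => rw [← μ.sum_eq]
    exact Finset.single_le_sum (f := fun k => (μ.comp k).sum) (fun _ _ => Nat.zero_le _)
      (Finset.mem_univ k)
  omega

/-- The last letter in the `k`-th component of `𝔱^μ`, if that component is nonempty. -/
def lastPos (μ : RComp r n) (k : Fin r) (h : μ.type k ≠ 0) : Fin n :=
  ⟨(μ.typeList.take (k + 1)).sum - 1, μ.lastPos_lt k h⟩

end RComp

/-! ### The elements `m_μ` and the modules `M^μ`

The enumeration `ζ_1, …, ζ_r` of the `r`-th roots of unity is `ζ_k = ζ ^ σ(k)`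
for a permutation `σ` of the exponents `0, …, r-1`. -/

variable {r n : ℕ}

/-- The root of unity `ζ_k`. -/
def root (σ : Equiv.Perm (Fin r)) (k : Fin r) : Base r := zeta r ^ (σ k : ℕ)

/-- `u_{i,k} = ∏_{l ≠ k} (t_i - ζ_l)` (the factors commute). -/
def u (σ : Equiv.Perm (Fin r)) (i : Fin n) (k : Fin r) : Y r n :=
  ((List.finRange r).map fun l =>
    if l ≠ k then (t i : Y r n) - algebraMap (Base r) (Y r n) (root σ l) else 1).prod

/-- `u_μ`: the product over the nonempty components `μ^{(k)}` of the elements `u_{a,k}`, with `a`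
the last letter of the `k`-th component of `𝔱^μ`. -/
def uComp (σ : Equiv.Perm (Fin r)) (μ : RComp r n) : Y r n :=
  ((List.finRange r).map fun k =>
    if h : μ.type k ≠ 0 then u σ (μ.lastPos k h) k else 1).prod

/-- `E_{A_μ}`, where the blocks of the set partition `A_μ` are the sets of letters of the nonempty
components of `𝔱^μ`. -/
def EA (μ : RComp r n) : Y r n :=
  ((List.finRange r).map fun k =>
    if μ.type k ≠ 0 then EI r (interval μ.typeList n k) else 1).prod

/-- `U_μ = u_μ E_{A_μ}`. -/
def U (σ : Equiv.Perm (Fin r)) (μ : RComp r n) : Y r n := uComp σ μ * EA μ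

open Classical in
/-- `x_μ = ∑_{w ∈ 𝔖_μ} q^{l(w)} g_w`. -/
def x (μ : RComp r n) : Y r n :=
  ∑ w : Equiv.Perm (Fin n) with w ∈ μ.S, q r ^ len w • gw r w

/-- `m_μ = U_μ x_μ`. -/
def m (σ : Equiv.Perm (Fin r)) (μ : RComp r n) : Y r n := U σ μ * x μ

/-- The right `Y_{r,n}`-module `M^μ = m_μ Y_{r,n}`. -/
def M (σ : Equiv.Perm (Fin r)) (μ : RComp r n) : Submodule (Y r n)ᵐᵒᵖ (Y r n) where
  carrier := Set.range fun h : Y r n => m σ μ * h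
  add_mem' := by
    rintro _ _ ⟨a, rfl⟩ ⟨b, rfl⟩
    exact ⟨a + b, mul_add _ _ _⟩
  zero_mem' := ⟨0, mul_zero _⟩
  smul_mem' := by
    rintro c _ ⟨a, rfl⟩
    exact ⟨a * c.unop, (mul_assoc _ _ _).symm⟩

/-- The element `m_μ h` of `M^μ`. -/
def mElt (σ : Equiv.Perm (Fin r)) (μ : RComp r n) (h : Y r n) : M σ μ :=
  ⟨m σ μ * h, h, rfl⟩

/-- `Hom_{Y_{r,n}}(M^ν, M^μ)`, the homomorphisms of right `Y_{r,n}`-modules. -/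
abbrev HomM (σ : Equiv.Perm (Fin r)) (ν μ : RComp r n) : Type :=
  M σ ν →ₗ[(Y r n)ᵐᵒᵖ] M σ μ

open Classical in
/-- `φ` is the map `φ_{μν}^d`, that is,
`φ (m_ν h) = ∑_{w ∈ 𝔖_μ d 𝔖_ν} q^{l(w)} U_μ g_w h` for all `h`. As every element of `M^ν` is of
the form `m_ν h`, there is at most one such `φ`. -/
def IsPhi (σ : Equiv.Perm (Fin r)) (μ ν : RComp r n) (d : Equiv.Perm (Fin n))
    (φ : HomM σ ν μ) : Prop :=
  ∀ h : Y r n, (φ (mElt σ ν h) : Y r n) =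
    ∑ w : Equiv.Perm (Fin n) with w ∈ DoubleCoset.doubleCoset d (μ.S : Set _) (ν.S : Set _),
      q r ^ len w • (U σ μ * gw r w * h)

end YokonumaSchur

end

/-! The `t_j` generate a commutative subalgebra, and `U σ μ` is a nonzero scalar multiple of its
primitive idempotent of weight `j ↦ root σ (μ.color j)` (`U_mul_t`, `U_eq_smul_theta`). Hence `U σ
μ` depends only on the type of `μ` and commutes with `gw r w` for `w ∈ μ.Sα` (`U_congr`,
`gw_mul_U`).

The elements `U σ μ * gw r w` form a basis of the right ideal generated by `U σ μ`. They span it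
because their span is stable under right multiplication (`comb_mul`). They are independent because
an explicit right representation `rep` on functions on the symmetric group recovers all coefficients
from the delta function at 1 (`comb_injective`). Elements of this ideal can therefore be handled as
coefficient functions `F`.

A homomorphism is determined by the image of `m σ ν`, which lies in this ideal. The torus weight of
`m σ ν` forces `F w = 0` unless `μ.color (w j) = ν.color j` for all `j` (`color_of_coeff_ne_zero`):
no such `w` exists when the types differ, and such `w` lie in `μ.Sα` when they agree. Since `m σ ν`
is a right and `m σ μ` a left eigenvector, with eigenvalue `q`, for the `g_i` of their Young
subgroups, `q^{-l(w)} F(w)` is constant on double cosets (`coeff_double_coset`).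

Conversely, for a double coset inside `μ.Sα`, the sum of the `q^{l(w)} U_μ g_w` factors both as `h'
* m σ ν` and as `m σ μ * h`, so left multiplication by `h'` is a homomorphism into `M σ μ`
(`dcosetHom`). Each double coset contains exactly one element of `RComp.DD μ ν` (`exists_rowInc`,
`eq_of_rowInc`), which yields the basis. -/

noncomputable section

namespace YokonumaSchur

/-! ### Lengths of permutations -/

section Length

variable {n : ℕ}

theorem lo_lt_hi (i : Fin (n - 1)) : lo i < hi i := by
  simp [lo, hi, Fin.lt_def]

@[simp] theorem simple_lo (i : Fin (n - 1)) : simple i (lo i) = hi i := Equiv.swap_apply_left _ _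

@[simp] theorem simple_hi (i : Fin (n - 1)) : simple i (hi i) = lo i := Equiv.swap_apply_right _ _

@[simp] theorem simple_mul_self (i : Fin (n - 1)) : simple i * simple i = 1 :=
  Equiv.swap_mul_self _ _

@[simp] theorem mul_simple_mul_simple (w : Equiv.Perm (Fin n)) (i : Fin (n - 1)) :
    w * simple i * simple i = w := by
  rw [mul_assoc, simple_mul_self, mul_one]

@[simp] theorem simple_mul_simple_mul (w : Equiv.Perm (Fin n)) (i : Fin (n - 1)) :
    simple i * (simple i * w) = w := by
  rw [← mul_assoc, simple_mul_self, one_mul]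

@[simp] theorem simple_inv (i : Fin (n - 1)) : (simple i)⁻¹ = simple i := Equiv.swap_inv _ _

@[simp] theorem simple_simple (i : Fin (n - 1)) (a : Fin n) : simple i (simple i a) = a := by
  rw [← Equiv.Perm.mul_apply, simple_mul_self, Equiv.Perm.one_apply]

theorem simple_apply_val (i : Fin (n - 1)) (a : Fin n) :
    (simple i a : ℕ) = if (a : ℕ) = i then (i : ℕ) + 1 else if (a : ℕ) = i + 1 then i else a := by
  simp only [simple, Equiv.swap_apply_def, lo, hi, Fin.ext_iff]
  split_ifs <;> rfl

theorem simple_lt_simple (i : Fin (n - 1)) {a b : Fin n} (h : a < b)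
    (h' : ¬ (a = lo i ∧ b = hi i)) : simple i a < simple i b := by
  simp only [Fin.lt_def, Fin.ext_iff, lo, hi, simple_apply_val] at *
  split_ifs <;> omega

/-- The inversions of a permutation. -/
def inversions (w : Equiv.Perm (Fin n)) : Finset (Fin n × Fin n) :=
  {p | p.1 < p.2 ∧ w p.2 < w p.1}

theorem mem_inversions {w : Equiv.Perm (Fin n)} {p : Fin n × Fin n} :
    p ∈ inversions w ↔ p.1 < p.2 ∧ w p.2 < w p.1 := by
  simp [inversions]

/-- The transposition reverses the order of the pair `(lo i, hi i)` only. It therefore carries the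
inversions of `w` to those of `w * simple i`, and that pair is the single new one. -/
theorem card_inversions_mul_simple {w : Equiv.Perm (Fin n)} {i : Fin (n - 1)}
    (h : w (lo i) < w (hi i)) :
    (inversions (w * simple i)).card = (inversions w).card + 1 := by
  classical
  have hs : inversions (w * simple i) = insert (lo i, hi i)
      ((inversions w).map (Equiv.prodCongr (simple i) (simple i)).toEmbedding) := by
    ext ⟨a, b⟩
    simp only [mem_inversions, Finset.mem_insert, Finset.mem_map, Equiv.Perm.mul_apply,
      Prod.exists, Equiv.toEmbedding_apply, Equiv.prodCongr_apply, Prod.map_apply, Prod.mk.injEq]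
    constructor
    · rintro ⟨hab, hw⟩
      by_cases h0 : a = lo i ∧ b = hi i
      · exact Or.inl h0
      · exact Or.inr ⟨simple i a, simple i b, ⟨simple_lt_simple i hab h0, hw⟩, by simp, by simp⟩
    · rintro (⟨rfl, rfl⟩ | ⟨c, d, ⟨hcd, hw⟩, rfl, rfl⟩)
      · simpa [lo_lt_hi] using h
      · have h0 : ¬ (c = lo i ∧ d = hi i) := by
          rintro ⟨rfl, rfl⟩
          exact absurd hw (not_lt.2 h.le)
        exact ⟨simple_lt_simple i hcd h0, by simpa using hw⟩
  rw [hs, Finset.card_insert_of_notMem, Finset.card_map]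
  simp only [Finset.mem_map, mem_inversions, Prod.exists, Equiv.toEmbedding_apply,
    Equiv.prodCongr_apply, Prod.map_apply, Prod.mk.injEq, not_exists, not_and]
  rintro a b ⟨hab, -⟩ ha hb
  have h1 : a = hi i := by rw [← simple_simple i a, ha, simple_lo]
  have h2 : b = lo i := by rw [← simple_simple i b, hb, simple_hi]
  subst h1 h2
  exact absurd hab (lo_lt_hi i).not_gt

theorem apply_lo_ne_apply_hi (w : Equiv.Perm (Fin n)) (i : Fin (n - 1)) : w (lo i) ≠ w (hi i) :=
  fun h => (lo_lt_hi i).ne (w.injective h)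

theorem card_inversions_mul_simple_of_gt {w : Equiv.Perm (Fin n)} {i : Fin (n - 1)}
    (h : w (hi i) < w (lo i)) :
    (inversions w).card = (inversions (w * simple i)).card + 1 := by
  have := card_inversions_mul_simple (w := w * simple i) (i := i) (by simpa using h)
  rwa [mul_simple_mul_simple] at this

theorem strictMono_of_simple {α : Type*} [Preorder α] {f : Fin n → α}
    (h : ∀ i : Fin (n - 1), f (lo i) < f (hi i)) : StrictMono f := by
  cases n with
  | zero => exact fun a => a.elim0
  | succ m => exact Fin.strictMono_iff_lt_succ.2 h

theorem perm_eq_one_of_strictMono {w : Equiv.Perm (Fin n)} (h : StrictMono w) : w = 1 := by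
  have := Subsingleton.elim (h.orderIsoOfSurjective w w.surjective) (OrderIso.refl (Fin n))
  ext a
  exact congrArg (fun f : Fin n ≃o Fin n => ((f a : Fin n) : ℕ)) this

theorem exists_descent {w : Equiv.Perm (Fin n)} (h : w ≠ 1) :
    ∃ i : Fin (n - 1), w (hi i) < w (lo i) := by
  by_contra! hc
  exact h (perm_eq_one_of_strictMono (strictMono_of_simple fun i =>
    lt_of_le_of_ne (hc i) (apply_lo_ne_apply_hi w i)))

@[simp] theorem wordProd_nil : wordProd ([] : List (Fin (n - 1))) = 1 := rfl

theorem wordProd_append (l l' : List (Fin (n - 1))) :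
    wordProd (l ++ l') = wordProd l * wordProd l' := by simp [wordProd]

@[simp] theorem wordProd_singleton (i : Fin (n - 1)) : wordProd [i] = simple i := by
  simp [wordProd]

theorem card_inversions_wordProd_le (l : List (Fin (n - 1))) :
    (inversions (wordProd l)).card ≤ l.length := by
  induction l using List.reverseRecOn with
  | nil =>
    rw [wordProd_nil, List.length_nil, nonpos_iff_eq_zero, Finset.card_eq_zero]
    ext p
    simpa [mem_inversions] using fun h => h.le
  | append_singleton l i ih =>
    rw [wordProd_append, wordProd_singleton, List.length_append, List.length_singleton]
    rcases lt_or_gt_of_ne (apply_lo_ne_apply_hi (wordProd l) i) with h | h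
    · rw [card_inversions_mul_simple h]; omega
    · have := card_inversions_mul_simple_of_gt h; omega

theorem exists_word_length_eq (w : Equiv.Perm (Fin n)) :
    ∃ l : List (Fin (n - 1)), wordProd l = w ∧ l.length = (inversions w).card := by
  induction hk : (inversions w).card generalizing w with
  | zero =>
    refine ⟨[], ?_, rfl⟩
    by_contra hne
    obtain ⟨i, hi⟩ := exists_descent (Ne.symm hne)
    have := card_inversions_mul_simple_of_gt hi
    omega
  | succ k ih =>
    have hne : w ≠ 1 := by
      rintro rfl
      have := card_inversions_wordProd_le ([] : List (Fin (n - 1)))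
      simp only [wordProd_nil, List.length_nil] at this
      omega
    obtain ⟨i, hi⟩ := exists_descent hne
    have := card_inversions_mul_simple_of_gt hi
    obtain ⟨l, hl, hl'⟩ := ih (w * simple i) (by omega)
    exact ⟨l ++ [i], by rw [wordProd_append, hl, wordProd_singleton, mul_simple_mul_simple],
      by simp [hl']⟩

/-- A simple transposition changes the number of inversions by exactly one, which bounds word length
from below; removing descents one at a time attains the bound. -/
theorem len_eq_card_inversions (w : Equiv.Perm (Fin n)) : len w = (inversions w).card := by
  apply le_antisymm
  · exact Nat.sInf_le (exists_word_length_eq w)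
  · obtain ⟨l, rfl, hl⟩ := exists_reduced_word w
    rw [← hl]
    exact card_inversions_wordProd_le l

theorem len_mul_simple {w : Equiv.Perm (Fin n)} {i : Fin (n - 1)}
    (h : w (lo i) < w (hi i)) : len (w * simple i) = len w + 1 := by
  rw [len_eq_card_inversions, len_eq_card_inversions, card_inversions_mul_simple h]

theorem len_mul_simple_of_gt {w : Equiv.Perm (Fin n)} {i : Fin (n - 1)}
    (h : w (hi i) < w (lo i)) : len w = len (w * simple i) + 1 := by
  rw [len_eq_card_inversions, len_eq_card_inversions, card_inversions_mul_simple_of_gt h]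

theorem len_wordProd_le (l : List (Fin (n - 1))) : len (wordProd l) ≤ l.length :=
  Nat.sInf_le ⟨l, rfl, rfl⟩

@[simp] theorem len_one : len (1 : Equiv.Perm (Fin n)) = 0 :=
  Nat.le_zero.1 (len_wordProd_le ([] : List (Fin (n - 1))))

theorem wordProd_reverse (l : List (Fin (n - 1))) : wordProd l.reverse = (wordProd l)⁻¹ := by
  induction l with
  | nil => simp
  | cons i l ih =>
    have h : wordProd (i :: l) = simple i * wordProd l := by simp [wordProd]
    rw [List.reverse_cons, wordProd_append, ih, h, wordProd_singleton, mul_inv_rev, simple_inv]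

theorem len_inv_le (w : Equiv.Perm (Fin n)) : len w⁻¹ ≤ len w := by
  obtain ⟨l, rfl, hl⟩ := exists_reduced_word w
  rw [← hl, ← wordProd_reverse]
  simpa using len_wordProd_le l.reverse

@[simp] theorem len_inv (w : Equiv.Perm (Fin n)) : len w⁻¹ = len w :=
  le_antisymm (len_inv_le w) (by simpa using len_inv_le w⁻¹)

theorem len_simple_mul {w : Equiv.Perm (Fin n)} {i : Fin (n - 1)}
    (h : w⁻¹ (lo i) < w⁻¹ (hi i)) : len (simple i * w) = len w + 1 := by
  rw [← len_inv, mul_inv_rev, simple_inv, len_mul_simple h, len_inv]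

theorem len_simple_mul_of_gt {w : Equiv.Perm (Fin n)} {i : Fin (n - 1)}
    (h : w⁻¹ (hi i) < w⁻¹ (lo i)) : len w = len (simple i * w) + 1 := by
  rw [← len_inv, len_mul_simple_of_gt h, ← len_inv, mul_inv_rev, simple_inv, inv_inv]

theorem len_simple (i : Fin (n - 1)) : len (simple i) = 1 := by
  simpa using len_mul_simple (w := 1) (i := i) (by simpa using lo_lt_hi i)

theorem apply_lo_lt_of_len {w : Equiv.Perm (Fin n)} {i : Fin (n - 1)}
    (h : len (w * simple i) = len w + 1) : w (lo i) < w (hi i) := by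
  by_contra hc
  have := len_mul_simple_of_gt (lt_of_le_of_ne (not_lt.1 hc) (apply_lo_ne_apply_hi w i).symm)
  omega

theorem hi_eq_lo {i j : Fin (n - 1)} (h : (j : ℕ) = i + 1) : hi i = lo j := by
  simp [hi, lo, h]

theorem simple_lo_of_far {i j : Fin (n - 1)} (h : (i : ℕ) + 2 ≤ j ∨ (j : ℕ) + 2 ≤ i) :
    simple i (lo j) = lo j :=
  Equiv.swap_apply_of_ne_of_ne (by simp only [lo, ne_eq, Fin.ext_iff]; omega)
    (by simp only [lo, hi, ne_eq, Fin.ext_iff]; omega)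

theorem simple_hi_of_far {i j : Fin (n - 1)} (h : (i : ℕ) + 2 ≤ j ∨ (j : ℕ) + 2 ≤ i) :
    simple i (hi j) = hi j :=
  Equiv.swap_apply_of_ne_of_ne (by simp only [lo, hi, ne_eq, Fin.ext_iff]; omega)
    (by simp only [hi, ne_eq, Fin.ext_iff]; omega)

theorem simple_hi_succ {i j : Fin (n - 1)} (h : (j : ℕ) = i + 1) : simple i (hi j) = hi j :=
  Equiv.swap_apply_of_ne_of_ne (by simp only [lo, hi, ne_eq, Fin.ext_iff]; omega)
    (by simp only [hi, ne_eq, Fin.ext_iff]; omega)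

theorem simple_succ_lo {i j : Fin (n - 1)} (h : (j : ℕ) = i + 1) : simple j (lo i) = lo i :=
  Equiv.swap_apply_of_ne_of_ne (by simp only [lo, ne_eq, Fin.ext_iff]; omega)
    (by simp only [lo, hi, ne_eq, Fin.ext_iff]; omega)

theorem mul_simple_mul_inv (w : Equiv.Perm (Fin n)) (i : Fin (n - 1)) :
    w * simple i * w⁻¹ = Equiv.swap (w (lo i)) (w (hi i)) :=
  (Equiv.swap_apply_apply w (lo i) (hi i)).symm

theorem simple_comm {i j : Fin (n - 1)} (h : (i : ℕ) + 2 ≤ j) :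
    simple i * simple j = simple j * simple i := by
  rw [← mul_inv_eq_iff_eq_mul, mul_simple_mul_inv, simple_lo_of_far (Or.inl h),
    simple_hi_of_far (Or.inl h), simple]

theorem simple_braid {i j : Fin (n - 1)} (h : (j : ℕ) = i + 1) :
    simple i * simple j * simple i = simple j * simple i * simple j := by
  have h1 := mul_simple_mul_inv (simple i) j
  have h2 := mul_simple_mul_inv (simple j) i
  rw [simple_inv] at h1 h2
  rw [h1, h2, ← hi_eq_lo h, simple_hi, simple_hi_succ h, simple_succ_lo h, hi_eq_lo h, simple_lo]

/-! ### Independence of the reduced word (Matsumoto's theorem). -/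

/-- Products of a family satisfying the braid relations along reduced words of one permutation
agree. -/
theorem prod_map_eq_of_reduced {A : Type*} [Monoid A] (f : Fin (n - 1) → A)
    (hcomm : ∀ i j : Fin (n - 1), (i : ℕ) + 2 ≤ j → f i * f j = f j * f i)
    (hbraid : ∀ i j : Fin (n - 1), (j : ℕ) = i + 1 → f i * f j * f i = f j * f i * f j)
    (l l' : List (Fin (n - 1))) (h : wordProd l = wordProd l')
    (hl : l.length = len (wordProd l)) (hl' : l'.length = len (wordProd l)) :
    (l.map f).prod = (l'.map f).prod := by
  induction hk : l.length generalizing l l' with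
  | zero =>
    have h0 : l'.length = 0 := by omega
    rw [List.length_eq_zero_iff.1 hk, List.length_eq_zero_iff.1 h0]
  | succ k ih =>
    obtain ⟨l₁, i, rfl⟩ : ∃ l₁ i, l = l₁ ++ [i] :=
      ⟨_, _, (List.dropLast_append_getLast (by rintro rfl; simp at hk)).symm⟩
    obtain ⟨l₂, j, rfl⟩ : ∃ l₂ j, l' = l₂ ++ [j] :=
      ⟨_, _, (List.dropLast_append_getLast (by rintro rfl; simp at hl'; omega)).symm⟩
    set w := wordProd (l₁ ++ [i]) with hw
    have hlen : len w = k + 1 := by omega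
    have h₁ : wordProd l₁ = w * simple i := by
      rw [hw, wordProd_append, wordProd_singleton, mul_simple_mul_simple]
    have h₂ : wordProd l₂ = w * simple j := by
      rw [h, wordProd_append, wordProd_singleton, mul_simple_mul_simple]
    simp only [List.length_append, List.length_singleton] at hl hl' hk
    have descent : ∀ (l₀ : List (Fin (n - 1))) (a : Fin (n - 1)), wordProd l₀ = w * simple a →
        l₀.length = k → w (hi a) < w (lo a) := by
      intro l₀ a h₀ hl₀
      by_contra hc
      have h1 := len_mul_simple (lt_of_le_of_ne (not_lt.1 hc) (apply_lo_ne_apply_hi w a))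
      have h2 := len_wordProd_le l₀
      rw [h₀] at h2
      omega
    have hdi := descent l₁ i h₁ (by omega)
    have hdj := descent l₂ j h₂ (by omega)
    have hli := len_mul_simple_of_gt hdi
    have hlj := len_mul_simple_of_gt hdj
    -- replacing a prefix by another reduced word of the same permutation
    have key : ∀ (l₀ m : List (Fin (n - 1))) (a : Fin (n - 1)), wordProd l₀ = w * simple a →
        l₀.length = k → wordProd m = w * simple a → m.length = k → len (w * simple a) = k →
        (l₀.map f).prod = (m.map f).prod := fun l₀ m a h1 h2 h3 h4 h5 =>
      ih l₀ m (by rw [h1, h3]) (by rw [h1]; omega) (by rw [h1]; omega) h2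
    -- Two commuting descents: `w` has reduced words `m j i` and `m i j` with a common prefix `m`.
    -- Induction rewrites the two given words into these, and one commutation joins them.
    have far : ∀ (l₁ l₂ : List (Fin (n - 1))) (i j : Fin (n - 1)), (i : ℕ) + 2 ≤ j →
        wordProd l₁ = w * simple i → wordProd l₂ = w * simple j → l₁.length = k →
        l₂.length = k → w (hi i) < w (lo i) → w (hi j) < w (lo j) →
        ((l₁ ++ [i]).map f).prod = ((l₂ ++ [j]).map f).prod := by
      intro l₁ l₂ i j hij h₁ h₂ hl₁ hl₂ hdi hdj
      have hli := len_mul_simple_of_gt hdi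
      have hlj := len_mul_simple_of_gt hdj
      have h3 := len_mul_simple_of_gt (w := w * simple i) (i := j) (by
        simpa [simple_lo_of_far (Or.inl hij), simple_hi_of_far (Or.inl hij)] using hdj)
      obtain ⟨m, hm, hml⟩ := exists_reduced_word (w * simple i * simple j)
      have e1 := key l₁ (m ++ [j]) i h₁ hl₁ (by
        rw [wordProd_append, hm, wordProd_singleton, mul_simple_mul_simple])
        (by simp only [List.length_append, List.length_singleton]; omega) (by omega)
      have e2 := key l₂ (m ++ [i]) j h₂ hl₂ (by
        rw [wordProd_append, hm, wordProd_singleton, mul_assoc w, simple_comm hij, ← mul_assoc,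
          mul_simple_mul_simple])
        (by simp only [List.length_append, List.length_singleton]; omega) (by omega)
      simp only [List.map_append, List.prod_append, List.map_singleton, List.prod_singleton]
        at e1 e2 ⊢
      rw [e1, e2, mul_assoc, mul_assoc, hcomm i j hij]
    -- Two adjacent descents: `w` reverses three consecutive letters, so it has reduced words `m i j
    -- i` and `m j i j`, joined by one braid relation.
    have near : ∀ (l₁ l₂ : List (Fin (n - 1))) (i j : Fin (n - 1)), (j : ℕ) = i + 1 →
        wordProd l₁ = w * simple i → wordProd l₂ = w * simple j → l₁.length = k →
        l₂.length = k → w (hi i) < w (lo i) → w (hi j) < w (lo j) →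
        ((l₁ ++ [i]).map f).prod = ((l₂ ++ [j]).map f).prod := by
      intro l₁ l₂ i j hij h₁ h₂ hl₁ hl₂ hdi hdj
      have hli := len_mul_simple_of_gt hdi
      have hlj := len_mul_simple_of_gt hdj
      have hdj' := hdj
      rw [← hi_eq_lo hij] at hdj'
      have h3 := len_mul_simple_of_gt (w := w * simple i) (i := j) (by
        simpa [simple_hi_succ hij, ← hi_eq_lo hij] using hdj'.trans hdi)
      have h4 := len_mul_simple_of_gt (w := w * simple i * simple j) (i := i) (by
        simpa [simple_hi_succ hij, hi_eq_lo hij, simple_succ_lo hij] using hdj)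
      obtain ⟨m, hm, hml⟩ := exists_reduced_word (w * simple i * simple j * simple i)
      have e1 := key l₁ (m ++ [i] ++ [j]) i h₁ hl₁ (by
        rw [wordProd_append, wordProd_append, hm, wordProd_singleton, wordProd_singleton,
          mul_simple_mul_simple, mul_simple_mul_simple])
        (by simp only [List.length_append, List.length_singleton]; omega) (by omega)
      have e2 := key l₂ (m ++ [j] ++ [i]) j h₂ hl₂ (by
        rw [wordProd_append, wordProd_append, hm, wordProd_singleton, wordProd_singleton,
          mul_assoc w, mul_assoc w, simple_braid hij, ← mul_assoc, ← mul_assoc,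
          mul_simple_mul_simple, mul_simple_mul_simple])
        (by simp only [List.length_append, List.length_singleton]; omega) (by omega)
      simp only [List.map_append, List.prod_append, List.map_singleton, List.prod_singleton]
        at e1 e2 ⊢
      rw [e1, e2]
      simpa only [mul_assoc] using congrArg ((m.map f).prod * ·) (hbraid i j hij)
    rcases lt_trichotomy (i : ℕ) j with hij | hij | hij
    · rcases Nat.lt_or_ge (i + 1) (j : ℕ) with hij' | hij'
      · exact far l₁ l₂ i j hij' h₁ h₂ (by omega) (by omega) hdi hdj
      · exact near l₁ l₂ i j (by omega) h₁ h₂ (by omega) (by omega) hdi hdj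
    · obtain rfl := Fin.ext hij
      have := key l₁ l₂ i h₁ (by omega) h₂ (by omega) (by omega)
      simp [this]
    · symm
      rcases Nat.lt_or_ge (j + 1) (i : ℕ) with hij' | hij'
      · exact far l₂ l₁ j i hij' h₂ h₁ (by omega) (by omega) hdj hdi
      · exact near l₂ l₁ j i (by omega) h₂ h₁ (by omega) (by omega) hdj hdi

end Length

/-! ### Young subgroups and distinguished coset representatives

A Young subgroup is described by the monotone function which sends a letter to its row. -/

section Rows

variable {n : ℕ}

/-- The permutations preserving the fibres of `ρ`. -/
def rowStab (ρ : Fin n → ℕ) : Subgroup (Equiv.Perm (Fin n)) where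
  carrier := {w | ∀ j, ρ (w j) = ρ j}
  one_mem' := fun _ => rfl
  mul_mem' := fun {a b} ha hb j => (ha (b j)).trans (hb j)
  inv_mem' := fun {a} ha j => by simpa using (ha (a⁻¹ j)).symm

theorem mem_rowStab {ρ : Fin n → ℕ} {w : Equiv.Perm (Fin n)} :
    w ∈ rowStab ρ ↔ ∀ j, ρ (w j) = ρ j := Iff.rfl

theorem simple_mem_rowStab {ρ : Fin n → ℕ} {i : Fin (n - 1)} (h : ρ (lo i) = ρ (hi i)) :
    simple i ∈ rowStab ρ := by
  intro j
  rw [simple, Equiv.swap_apply_def]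
  split_ifs with h1 h2
  · rw [h1, h]
  · rw [h2, h]
  · rfl

theorem row_eq_of_descent {ρ : Fin n → ℕ} (hρ : Monotone ρ) {w : Equiv.Perm (Fin n)}
    (hw : w ∈ rowStab ρ) {i : Fin (n - 1)} (h : w (hi i) < w (lo i)) : ρ (lo i) = ρ (hi i) :=
  le_antisymm (hρ (lo_lt_hi i).le) (by rw [← hw (hi i), ← hw (lo i)]; exact hρ h.le)

/-- Monotonicity of `ρ` forces every descent of a row-preserving permutation to lie within a row, so
descents can be stripped without leaving the subgroup. -/
theorem rowStab_induction {ρ : Fin n → ℕ} (hρ : Monotone ρ) {P : Equiv.Perm (Fin n) → Prop}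
    (one : P 1)
    (mul_simple : ∀ w ∈ rowStab ρ, ∀ i, ρ (lo i) = ρ (hi i) → w (lo i) < w (hi i) → P w →
      P (w * simple i)) (w : Equiv.Perm (Fin n)) (hw : w ∈ rowStab ρ) : P w := by
  induction hk : len w generalizing w with
  | zero =>
    by_cases h : w = 1
    · rwa [h]
    · obtain ⟨i, hi⟩ := exists_descent h
      have := len_mul_simple_of_gt hi
      omega
  | succ k ih =>
    by_cases h : w = 1
    · rwa [h]
    · obtain ⟨i, hi⟩ := exists_descent h
      have h1 := len_mul_simple_of_gt hi
      have h2 := row_eq_of_descent hρ hw hi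
      have h3 := mul_mem hw (simple_mem_rowStab h2)
      have := mul_simple _ h3 i h2 (by simpa using hi) (ih _ h3 (by omega))
      rwa [mul_simple_mul_simple] at this

/-- `d` is increasing on the fibres of the monotone function `ρ`. -/
def RowInc (ρ : Fin n → ℕ) (d : Equiv.Perm (Fin n)) : Prop :=
  StrictMono fun j => toLex (ρ j, d j)

theorem RowInc.lt {ρ : Fin n → ℕ} {d : Equiv.Perm (Fin n)} (h : RowInc ρ d) {a b : Fin n}
    (hab : a < b) (hr : ρ a = ρ b) : d a < d b := by
  have := h hab
  simpa [Prod.Lex.toLex_lt_toLex, hr] using this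

/-- The lexicographic form of `RowInc` pays off here: strict monotonicity need only be tested on
adjacent letters. -/
theorem rowInc_of_simple {ρ : Fin n → ℕ} (hρ : Monotone ρ) {d : Equiv.Perm (Fin n)}
    (h : ∀ i, ρ (lo i) = ρ (hi i) → d (lo i) < d (hi i)) : RowInc ρ d := by
  refine strictMono_of_simple fun i => ?_
  rw [Prod.Lex.toLex_lt_toLex]
  rcases (hρ (lo_lt_hi i).le).lt_or_eq with h1 | h1
  · exact Or.inl h1
  · exact Or.inr ⟨h1, h i h1⟩

theorem len_mul_of_rowInc {ρ : Fin n → ℕ} (hρ : Monotone ρ) {d : Equiv.Perm (Fin n)}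
    (hd : RowInc ρ d) {v : Equiv.Perm (Fin n)} (hv : v ∈ rowStab ρ) :
    len (d * v) = len d + len v := by
  refine rowStab_induction hρ (P := fun v => len (d * v) = len d + len v) (by simp) ?_ v hv
  intro w hw i hr hlt ih
  rw [← mul_assoc, len_mul_simple, len_mul_simple hlt, ih, add_assoc]
  exact hd.lt hlt (by rw [hw, hw, hr])

theorem len_mul_of_rowInc_inv {ρ : Fin n → ℕ} (hρ : Monotone ρ) {d : Equiv.Perm (Fin n)}
    (hd : RowInc ρ d⁻¹) {v : Equiv.Perm (Fin n)} (hv : v ∈ rowStab ρ) :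
    len (v * d) = len v + len d := by
  rw [← len_inv, mul_inv_rev, len_mul_of_rowInc hρ hd (inv_mem hv), len_inv, len_inv, add_comm]

/-- Translates the additivity of lengths that defines `RComp.D` into an order condition. The
converse tests only the simple transpositions in the stabilizer. -/
theorem rowInc_inv_iff {ρ : Fin n → ℕ} (hρ : Monotone ρ) {d : Equiv.Perm (Fin n)} :
    RowInc ρ d⁻¹ ↔ ∀ v ∈ rowStab ρ, len (v * d) = len v + len d := by
  refine ⟨fun h v hv => len_mul_of_rowInc_inv hρ h hv, fun h => ?_⟩
  refine rowInc_of_simple hρ fun i hi => apply_lo_lt_of_len ?_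
  have := h _ (simple_mem_rowStab hi)
  rw [len_simple, ← len_inv, mul_inv_rev, simple_inv] at this
  rw [this, len_inv, add_comm]

/-! ### Distinguished representatives of double cosets. -/

/-- A double coset contains at most one distinguished representative. -/
theorem eq_of_rowInc {ρ ρ' : Fin n → ℕ} (hρ : Monotone ρ)
    {d d' a b : Equiv.Perm (Fin n)} (ha : a ∈ rowStab ρ) (hb : b ∈ rowStab ρ')
    (h1 : RowInc ρ d⁻¹) (h2 : RowInc ρ' d) (h1' : RowInc ρ d'⁻¹) (h2' : RowInc ρ' d')
    (h : d' = a * d * b) : d' = d := by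
  have hmono : ∀ c : Equiv.Perm (Fin n), RowInc ρ' c →
      Monotone fun j => toLex (ρ' j, ρ (c j)) := by
    intro c hc i j hij
    have := hc.monotone hij
    rw [Prod.Lex.toLex_le_toLex] at this ⊢
    exact this.imp id fun h => ⟨h.1, hρ h.2⟩
  have hrow : ∀ j, ρ (d' j) = ρ (d (b j)) := fun j => by
    rw [h, Equiv.Perm.mul_apply, Equiv.Perm.mul_apply, ha]
  have hfb : (fun j => toLex (ρ' j, ρ (d j))) ∘ b = fun j => toLex (ρ' j, ρ (d' j)) := by
    funext j
    simp only [Function.comp, hrow, hb j]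
  -- The tuples `(ρ' j, ρ (d j))` and `(ρ' j, ρ (d' j))` are both monotone and differ by the
  -- rearrangement `b`. A monotone rearrangement is unique, so `d` and `d'` send each letter to the
  -- same row.
  have hu := Tuple.unique_monotone (f := fun j => toLex (ρ' j, ρ (d j))) (σ := b) (τ := 1)
    (by rw [hfb]; exact hmono d' h2') (hmono d h2)
  rw [hfb] at hu
  have hrow' : ∀ j, ρ (d' j) = ρ (d j) := fun j => congrArg (fun p => (ofLex p).2) (congrFun hu j)
  rw [← mul_inv_eq_one]
  refine perm_eq_one_of_strictMono fun x y hxy => ?_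
  -- The strictly increasing map attached to `d'⁻¹`, composed with `d' * d⁻¹`, is the one attached
  -- to `d⁻¹`. So `d' * d⁻¹` is itself increasing, hence trivial.
  have hG : ∀ x, toLex (ρ ((d' * d⁻¹) x), d'⁻¹ ((d' * d⁻¹) x)) = toLex (ρ x, d⁻¹ x) := by
    intro x
    simp [hrow']
  have := h1 hxy
  simp only [← hG] at this
  exact h1'.lt_iff_lt.1 this

/-- Descent on length: a failure of either condition exhibits a transposition, inside a row, that
shortens `w` without leaving its double coset. -/
theorem exists_rowInc {ρ ρ' : Fin n → ℕ} (hρ : Monotone ρ) (hρ' : Monotone ρ')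
    (w : Equiv.Perm (Fin n)) : ∃ a ∈ rowStab ρ, ∃ b ∈ rowStab ρ',
      RowInc ρ (a * w * b)⁻¹ ∧ RowInc ρ' (a * w * b) := by
  induction hk : len w using Nat.strong_induction_on generalizing w with
  | _ k ih =>
    by_cases h1 : RowInc ρ w⁻¹
    · by_cases h2 : RowInc ρ' w
      · exact ⟨1, one_mem _, 1, one_mem _, by simpa using h1, by simpa using h2⟩
      · obtain ⟨i, hr, hi⟩ : ∃ i, ρ' (lo i) = ρ' (hi i) ∧ ¬ w (lo i) < w (hi i) := by
          by_contra! hc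
          exact h2 (rowInc_of_simple hρ' hc)
        have hl := len_mul_simple_of_gt
          (lt_of_le_of_ne (not_lt.1 hi) (apply_lo_ne_apply_hi w i).symm)
        obtain ⟨a, ha, b, hb, h⟩ := ih _ (by omega) (w * simple i) rfl
        exact ⟨a, ha, simple i * b, mul_mem (simple_mem_rowStab hr) hb, by
          simpa only [mul_assoc] using h⟩
    · obtain ⟨i, hr, hi⟩ : ∃ i, ρ (lo i) = ρ (hi i) ∧ ¬ w⁻¹ (lo i) < w⁻¹ (hi i) := by
        by_contra! hc
        exact h1 (rowInc_of_simple hρ hc)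
      have hl := len_simple_mul_of_gt
        (lt_of_le_of_ne (not_lt.1 hi) (apply_lo_ne_apply_hi w⁻¹ i).symm)
      obtain ⟨a, ha, b, hb, h⟩ := ih _ (by omega) (simple i * w) rfl
      exact ⟨a * simple i, mul_mem ha (simple_mem_rowStab hr), b, hb, by
        simpa only [mul_assoc] using h⟩

/-- One-sided cosets are double cosets for the row function `j ↦ (j : ℕ)`, whose stabilizer is
trivial. -/
theorem exists_rowInc_mul {ρ : Fin n → ℕ} (hρ : Monotone ρ) (w : Equiv.Perm (Fin n)) :
    ∃ b ∈ rowStab ρ, RowInc ρ (w * b) := by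
  obtain ⟨a, ha, b, hb, -, h⟩ :=
    exists_rowInc (ρ := fun j => (j : ℕ)) (fun _ _ h => h) hρ w
  have : a = 1 := Equiv.ext fun j => Fin.ext (ha j)
  exact ⟨b, hb, by simpa [this] using h⟩

theorem eq_of_rowInc_mul {ρ : Fin n → ℕ} {d d' b : Equiv.Perm (Fin n)}
    (hb : b ∈ rowStab ρ) (h : RowInc ρ d) (h' : RowInc ρ d') (he : d' = d * b) : d' = d := by
  have hinc : ∀ c : Equiv.Perm (Fin n), RowInc (fun j => (j : ℕ)) c := fun c =>
    rowInc_of_simple (fun _ _ h => h) fun i hi => absurd (Fin.ext hi) (lo_lt_hi i).ne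
  exact eq_of_rowInc (ρ := fun j => (j : ℕ)) (fun _ _ h => h) (one_mem _) hb (hinc _) h (hinc _)
    h' (by simpa using he)

open Classical in
theorem sum_eq_sum_rowInc_mul {A : Type*} [AddCommMonoid A] {ρ : Fin n → ℕ} (hρ : Monotone ρ)
    (C : Set (Equiv.Perm (Fin n))) (hC : ∀ w ∈ C, ∀ v ∈ rowStab ρ, w * v ∈ C)
    (f : Equiv.Perm (Fin n) → A) :
    ∑ w with w ∈ C, f w =
      ∑ d with d ∈ C ∧ RowInc ρ d, ∑ v with v ∈ rowStab ρ, f (d * v) := by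
  rw [← Finset.sum_product']
  symm
  refine Finset.sum_bij (fun p _ => p.1 * p.2) ?_ ?_ ?_ ?_
  · rintro ⟨d, v⟩ h
    simp only [Finset.mem_product, Finset.mem_filter, Finset.mem_univ, true_and] at h ⊢
    exact hC _ h.1.1 _ h.2
  · rintro ⟨d, v⟩ h ⟨d', v'⟩ h' he
    simp only [Finset.mem_product, Finset.mem_filter, Finset.mem_univ, true_and] at h h' he
    have : d = d' := eq_of_rowInc_mul (mul_mem h'.2 (inv_mem h.2)) h'.1.2 h.1.2 (by
      rw [← mul_assoc, ← he, mul_inv_cancel_right])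
    subst this
    rw [mul_left_cancel he]
  · intro w hw
    simp only [Finset.mem_filter, Finset.mem_univ, true_and] at hw
    obtain ⟨b, hb, h⟩ := exists_rowInc_mul hρ w
    refine ⟨(w * b, b⁻¹), ?_, by simp⟩
    simp only [Finset.mem_product, Finset.mem_filter, Finset.mem_univ, true_and]
    exact ⟨⟨hC _ hw _ hb, h⟩, inv_mem hb⟩
  · intros; rfl

open Classical in
theorem sum_eq_sum_mul_rowInc {A : Type*} [AddCommMonoid A] {ρ : Fin n → ℕ} (hρ : Monotone ρ)
    (C : Set (Equiv.Perm (Fin n))) (hC : ∀ w ∈ C, ∀ v ∈ rowStab ρ, v * w ∈ C)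
    (f : Equiv.Perm (Fin n) → A) :
    ∑ w with w ∈ C, f w =
      ∑ d with d ∈ C ∧ RowInc ρ d⁻¹, ∑ v with v ∈ rowStab ρ, f (v * d) := by
  have hinv : ∀ (p : Equiv.Perm (Fin n) → Prop) [DecidablePred p] (F : Equiv.Perm (Fin n) → A),
      ∑ w with p w, F w = ∑ w with p w⁻¹, F w⁻¹ := by
    intro p _ F
    rw [Finset.sum_filter, Finset.sum_filter]
    exact (Equiv.sum_comp (Equiv.inv (Equiv.Perm (Fin n))) fun w => if p w then F w else 0).symm
  rw [hinv, hinv (fun d => d ∈ C ∧ RowInc ρ d⁻¹)]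
  simp only [inv_inv]
  refine (sum_eq_sum_rowInc_mul hρ {w | w⁻¹ ∈ C} ?_ _).trans ?_
  · intro w hw v hv
    simpa using hC _ hw _ (inv_mem hv)
  · refine Finset.sum_congr rfl fun d _ => ?_
    rw [hinv (fun v => v ∈ rowStab ρ)]
    simp only [inv_mem_iff, mul_inv_rev, inv_inv]

end Rows

/-! ### The row function of a list of row lengths -/

section RowOf

variable {n : ℕ}

/-- The index of the interval containing a letter. -/
def rowOf (L : List ℕ) (n : ℕ) (j : Fin n) : ℕ := sInf {k | (j : ℕ) < (L.take (k + 1)).sum}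

theorem take_sum_mono (L : List ℕ) : Monotone fun k => (L.take k).sum := by
  refine monotone_nat_of_le_succ fun k => ?_
  rw [List.take_add_one, List.sum_append]
  exact Nat.le_add_right _ _

theorem lt_take_rowOf {L : List ℕ} (hL : L.sum = n) (j : Fin n) :
    (j : ℕ) < (L.take (rowOf L n j + 1)).sum :=
  Nat.sInf_mem (s := {k | (j : ℕ) < (L.take (k + 1)).sum})
    ⟨L.length, by
      simp only [Set.mem_ofPred_eq]
      rw [List.take_of_length_le (Nat.le_succ _), hL]; exact j.2⟩

/-- This adjunction between partial sums and row indices handles entries equal to zero without a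
case distinction. -/
theorem take_sum_le_iff {L : List ℕ} (hL : L.sum = n) (j : Fin n) (k : ℕ) :
    (L.take k).sum ≤ j ↔ k ≤ rowOf L n j := by
  constructor
  · intro h
    by_contra hc
    have := take_sum_mono L (show rowOf L n j + 1 ≤ k by omega)
    have := lt_take_rowOf hL j
    simp only at *
    omega
  · intro h
    cases k with
    | zero => simp
    | succ k =>
      by_contra hc
      have : rowOf L n j ≤ k := Nat.sInf_le (not_le.1 hc)
      omega

theorem mem_interval_iff {L : List ℕ} (hL : L.sum = n) (j : Fin n) (k : ℕ) :
    j ∈ interval L n k ↔ rowOf L n j = k := by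
  rw [interval, Finset.mem_filter, ← not_le, take_sum_le_iff hL, take_sum_le_iff hL]
  simp only [Finset.mem_univ, true_and]
  omega

theorem rowOf_mono {L : List ℕ} (hL : L.sum = n) : Monotone (rowOf L n) := by
  intro a b hab
  rw [← take_sum_le_iff hL]
  exact ((take_sum_le_iff hL a _).2 le_rfl).trans hab

theorem young_eq_rowStab {L : List ℕ} (hL : L.sum = n) : young L n = rowStab (rowOf L n) := by
  ext w
  change (∀ k j, w j ∈ interval L n k ↔ j ∈ interval L n k) ↔ _
  simp only [mem_interval_iff hL, mem_rowStab]
  exact ⟨fun h j => (h _ j).2 rfl, fun h k j => by rw [h]⟩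

theorem rowOf_lt {L : List ℕ} (hL : L.sum = n) (j : Fin n) : rowOf L n j < L.length := by
  by_contra hc
  have h1 := (take_sum_le_iff hL j _).2 (not_lt.1 hc)
  rw [List.take_length, hL] at h1
  exact absurd j.2 (not_lt.2 h1)

theorem card_interval {L : List ℕ} (hL : L.sum = n) {k : ℕ} (hk : k < L.length) :
    (interval L n k).card = L[k] := by
  have h1 : (L.take (k + 1)).sum = (L.take k).sum + L[k] := by
    rw [List.take_succ_eq_append_getElem hk, List.sum_append, List.sum_singleton]
  have h2 : (L.take (k + 1)).sum ≤ n := by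
    conv_rhs => rw [← hL, ← List.sum_take_add_sum_drop L (k + 1)]
    exact Nat.le_add_right _ _
  have h3 : (interval L n k).map Fin.valEmbedding =
      Finset.Ico (L.take k).sum (L.take (k + 1)).sum := by
    ext a
    simp only [interval, Finset.mem_map, Finset.mem_filter, Finset.mem_univ, true_and,
      Fin.valEmbedding_apply, Finset.mem_Ico]
    constructor
    · rintro ⟨j, hj, rfl⟩
      exact hj
    · intro h
      exact ⟨⟨a, by omega⟩, h, rfl⟩
  rw [← Finset.card_map Fin.valEmbedding, h3, Nat.card_Ico, h1, Nat.add_sub_cancel_left]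

theorem take_map_sum (L : List (List ℕ)) (k : ℕ) :
    ((L.map List.sum).take k).sum = (L.flatten.take (L.take k).flatten.length).sum := by
  have : L.flatten = (L.take k).flatten ++ (L.drop k).flatten := by
    rw [← List.flatten_append, List.take_append_drop]
  rw [this, List.take_left, ← List.map_take, List.sum_flatten]

namespace RComp

variable {r : ℕ}

/-- The row of a letter in `𝔱^μ`. -/
def row (μ : RComp r n) : Fin n → ℕ := rowOf μ.rows n

/-- The component of a letter in `𝔱^μ`. -/
def color (μ : RComp r n) (j : Fin n) : Fin r :=
  ⟨rowOf μ.typeList n j, by simpa [typeList] using rowOf_lt μ.typeList_sum j⟩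

theorem typeList_eq_map (μ : RComp r n) : μ.typeList = (List.ofFn μ.comp).map List.sum := by
  rw [List.map_ofFn]; rfl

theorem rows_sum (μ : RComp r n) : μ.rows.sum = n := by
  rw [rows, List.sum_flatten, ← typeList_eq_map, typeList_sum]

theorem row_mono (μ : RComp r n) : Monotone μ.row := rowOf_mono μ.rows_sum

theorem S_eq (μ : RComp r n) : μ.S = rowStab μ.row := young_eq_rowStab μ.rows_sum

theorem mem_Sα (μ : RComp r n) {w : Equiv.Perm (Fin n)} :
    w ∈ μ.Sα ↔ ∀ j, μ.color (w j) = μ.color j := by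
  rw [Sα, young_eq_rowStab μ.typeList_sum, mem_rowStab]
  simp only [color, Fin.mk.injEq]

theorem Sα_eq (μ : RComp r n) : μ.Sα = rowStab fun j => (μ.color j : ℕ) :=
  young_eq_rowStab μ.typeList_sum

theorem mem_interval_typeList (μ : RComp r n) (j : Fin n) (k : Fin r) :
    j ∈ interval μ.typeList n k ↔ μ.color j = k := by
  rw [mem_interval_iff μ.typeList_sum, color, Fin.ext_iff]

/-- By `take_map_sum`, every boundary between components is a boundary between rows, so letters of
one row are never separated by it. -/
theorem color_eq_of_row_eq (μ : RComp r n) {a b : Fin n} (h : μ.row a = μ.row b) :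
    μ.color a = μ.color b := by
  have key : ∀ k, (μ.typeList.take k).sum ≤ a ↔ (μ.typeList.take k).sum ≤ b := by
    intro k
    rw [typeList_eq_map, take_map_sum]
    exact (take_sum_le_iff μ.rows_sum a _).trans
      ((show _ ↔ _ by rw [← row, h, row]).trans (take_sum_le_iff μ.rows_sum b _).symm)
  simp only [take_sum_le_iff μ.typeList_sum] at key
  exact Fin.ext (le_antisymm ((key _).1 le_rfl) ((key _).2 le_rfl))

theorem S_le_Sα (μ : RComp r n) : μ.S ≤ μ.Sα := by
  intro w hw
  rw [S_eq] at hw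
  rw [mem_Sα]
  exact fun j => μ.color_eq_of_row_eq (hw j)

theorem mem_D_iff (μ : RComp r n) {d : Equiv.Perm (Fin n)} : d ∈ μ.D ↔ RowInc μ.row d⁻¹ := by
  rw [rowInc_inv_iff μ.row_mono, ← S_eq]; rfl

theorem card_color (μ : RComp r n) (k : Fin r) :
    (Finset.univ.filter fun j => μ.color j = k).card = μ.type k := by
  have h : (k : ℕ) < μ.typeList.length := by simp [typeList]
  have := card_interval μ.typeList_sum h
  simp only [typeList, List.getElem_ofFn] at this
  rw [← this]
  congr 1
  ext j
  simp only [Finset.mem_filter, Finset.mem_univ, true_and, ← mem_interval_typeList, typeList]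

theorem type_eq_of_color (μ ν : RComp r n) (w : Equiv.Perm (Fin n))
    (h : ∀ j, μ.color (w j) = ν.color j) : μ.type = ν.type := by
  funext k
  rw [← card_color, ← card_color]
  refine (Finset.card_bij (fun j _ => w j) ?_ ?_ ?_).symm
  · intro j hj
    simpa [h] using hj
  · intro a _ b _ hab
    exact w.injective hab
  · intro j hj
    exact ⟨w⁻¹ j, by simpa [← h] using hj, by simp⟩

theorem typeList_congr {μ ν : RComp r n} (h : μ.type = ν.type) : μ.typeList = ν.typeList := by
  rw [typeList, typeList, h]

theorem color_congr {μ ν : RComp r n} (h : μ.type = ν.type) : μ.color = ν.color := by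
  funext j
  simp only [color, typeList_congr h]

end RComp

end RowOf

/-! ### The ground ring -/

section BaseRing

variable {r : ℕ}

instance : IsDomain (Base r) :=
  inferInstanceAs (IsDomain (AddMonoidAlgebra (Coeff r) ℤ))

theorem q_mul_qinv (r : ℕ) : q r * qinv r = 1 :=
  (LaurentPolynomial.T_add (R := Coeff r) 1 (-1)).symm.trans
    (by rw [add_neg_cancel]; exact LaurentPolynomial.T_zero)

theorem q_ne_zero (r : ℕ) : q r ≠ 0 := left_ne_zero_of_mul_eq_one (q_mul_qinv r)

theorem q_pow_mul_qinv_pow (r k : ℕ) : q r ^ k * qinv r ^ k = 1 := by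
  rw [← mul_pow, q_mul_qinv, one_pow]

/-- The embedding of the coefficients into the ground ring. -/
def coeffHom (r : ℕ) : Coeff r →+* Base r := LaurentPolynomial.C (R := Coeff r)

theorem coeffHom_injective (r : ℕ) : Function.Injective (coeffHom r) :=
  AddMonoidAlgebra.single_right_injective (R := Coeff r) (M := ℤ)

theorem isPrimitiveRoot_zeta (hr : 1 ≤ r) : IsPrimitiveRoot (zeta r) r := by
  have h1 : IsPrimitiveRoot (zetaC r) r := Complex.isPrimitiveRoot_exp r (by omega)
  have h2 : IsPrimitiveRoot
      (⟨zetaC r, Algebra.subset_adjoin (by simp)⟩ : Coeff r) r :=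
    IsPrimitiveRoot.of_map_of_injective (f := (Algebra.adjoin ℤ _).val) h1 Subtype.val_injective
  exact h2.map_of_injective (f := coeffHom r) (coeffHom_injective r)

theorem invr_mul (hr : 1 ≤ r) : invr r * (r : Base r) = 1 := by
  have h : (⟨(r : ℂ)⁻¹, Algebra.subset_adjoin (by simp)⟩ : Coeff r) * (r : Coeff r) = 1 := by
    apply Subtype.ext
    have : (r : ℂ) ≠ 0 := by exact_mod_cast (show r ≠ 0 by omega)
    simp [this]
  have := congrArg (coeffHom r) h
  rwa [map_mul, map_one, map_natCast] at this

theorem root_pow (hr : 1 ≤ r) (σ : Equiv.Perm (Fin r)) (k : Fin r) : root σ k ^ r = 1 := by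
  rw [root, ← pow_mul, mul_comm, pow_mul, (isPrimitiveRoot_zeta hr).pow_eq_one, one_pow]

theorem root_injective (hr : 1 ≤ r) (σ : Equiv.Perm (Fin r)) : Function.Injective (root σ) :=
  fun k l h => σ.injective
    (Fin.ext ((isPrimitiveRoot_zeta hr).pow_inj (σ k).2 (σ l).2 h))

open Polynomial in
theorem prod_X_sub_root (hr : 1 ≤ r) (σ : Equiv.Perm (Fin r)) :
    ∏ l, (X - C (root σ l)) = (X : (Base r)[X]) ^ r - 1 := by
  rw [X_pow_sub_one_eq_prod hr (isPrimitiveRoot_zeta hr)]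
  refine Finset.prod_bij (fun l _ => root σ l) ?_ ?_ ?_ ?_
  · intro l _
    rw [mem_nthRootsFinset hr, root_pow hr]
  · intro k _ l _ h
    exact root_injective hr σ h
  · intro x hx
    have : NeZero r := ⟨by omega⟩
    rw [mem_nthRootsFinset hr] at hx
    obtain ⟨i, hi, rfl⟩ := (isPrimitiveRoot_zeta hr).eq_pow_of_pow_eq_one hx
    exact ⟨σ⁻¹ ⟨i, hi⟩, Finset.mem_univ _, by simp [root]⟩
  · intros; rfl

theorem map_avg {A B : Type} [Semiring A] [Semiring B] [Algebra (Base r) A] [Algebra (Base r) B]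
    (f : A →ₐ[Base r] B) (a b : A) : f (avg r a b) = avg r (f a) (f b) := by
  simp [avg, map_sum]

/-- A geometric sum. Once `a ^ r = b ^ r`, multiplication by `avg r a b` identifies `a` with `b`. -/
theorem avg_mul_sub {A : Type} [CommRing A] [Algebra (Base r) A] (a b : A) :
    avg r a b * (a - b) = invr r • (b * (a ^ r - b ^ r)) := by
  rw [avg, smul_mul_assoc, ← geom_sum₂_mul, ← mul_assoc, Finset.mul_sum]
  congr 2
  refine Finset.sum_congr rfl fun s hs => ?_
  rw [Finset.mem_range] at hs
  -- The geometric sum has exponents `r - 1 - s`, whereas `avg` has `r - s`; this is the extra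
  -- factor `b`.
  rw [show r - s = (r - 1 - s) + 1 by omega, pow_succ]
  ring

/-- Orthogonality of characters: the diagonal case uses that `r` is invertible, the other case that
the ground ring is a domain. -/
theorem avg_root (hr : 1 ≤ r) (σ : Equiv.Perm (Fin r)) (k l : Fin r) :
    avg r (root σ k) (root σ l) = if k = l then 1 else 0 := by
  split_ifs with h
  · subst h
    rw [avg, Finset.sum_congr rfl (g := fun _ => 1), Finset.sum_const, Finset.card_range,
      nsmul_one, smul_eq_mul, invr_mul hr]
    intro s hs
    rw [Finset.mem_range] at hs
    rw [← pow_add, show s + (r - s) = r by omega, root_pow hr]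
  · have := avg_mul_sub (r := r) (root σ k) (root σ l)
    rw [root_pow hr, root_pow hr, sub_self, mul_zero, smul_zero] at this
    exact (mul_eq_zero.1 this).resolve_right (sub_ne_zero.2 fun h' => h (root_injective hr σ h'))

end BaseRing

/-! ### Relations in the Yokonuma-Hecke algebra -/

section Relations

variable {r n : ℕ}

theorem mk_eq_of_rel {a b : Free r n} (h : Rel r n a b) : mk r n a = mk r n b :=
  RingQuot.mkAlgHom_rel (Base r) h

theorem t_mul_t (i j : Fin n) : (t i * t j : Y r n) = t j * t i := by
  exact (by simpa only [map_mul] using mk_eq_of_rel (Rel.comm_t (r := r) i j) :)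

theorem t_pow (i : Fin n) : (t i ^ r : Y r n) = 1 := by
  exact (by simpa only [map_pow, map_one] using mk_eq_of_rel (Rel.t_pow (r := r) i) :)

theorem g_mul_t (i : Fin (n - 1)) (j : Fin n) : (g i * t j : Y r n) = t (simple i j) * g i := by
  exact (by simpa only [map_mul] using mk_eq_of_rel (Rel.g_t (r := r) i j) :)

theorem g_mul_g {i j : Fin (n - 1)} (h : (i : ℕ) + 2 ≤ j) : (g i * g j : Y r n) = g j * g i := by
  exact (by simpa only [map_mul] using mk_eq_of_rel (Rel.comm_g (r := r) i j (Or.inl h)) :)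

theorem g_braid {i j : Fin (n - 1)} (h : (j : ℕ) = i + 1) :
    (g i * g j * g i : Y r n) = g j * g i * g j := by
  exact (by simpa only [map_mul] using mk_eq_of_rel (Rel.braid (r := r) i j h) :)

theorem g_mul_self (i : Fin (n - 1)) :
    (g i * g i : Y r n) = 1 + (q r - qinv r) • (e (lo i) (hi i) * g i) := by
  have := mk_eq_of_rel (Rel.g_sq (r := r) i)
  rwa [map_pow, map_add, map_one, map_smul, map_mul, map_avg, pow_two] at this

theorem Y_induction {P : Y r n → Prop} (algebraMap : ∀ c, P (algebraMap (Base r) (Y r n) c))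
    (t : ∀ j, P (t j)) (g : ∀ i, P (g i)) (add : ∀ a b, P a → P b → P (a + b))
    (mul : ∀ a b, P a → P b → P (a * b)) (y : Y r n) : P y := by
  obtain ⟨f, rfl⟩ := RingQuot.mkAlgHom_surjective (Base r) (Rel r n) y
  change P (mk r n f)
  induction f using FreeAlgebra.induction with
  | grade0 c => rw [AlgHom.commutes]; exact algebraMap c
  | grade1 x =>
    rcases x with j | i
    · exact t j
    · exact g i
  | mul a b ha hb => rw [map_mul]; exact mul _ _ ha hb
  | add a b ha hb => rw [map_add]; exact add _ _ ha hb

@[simp] theorem wordProd_reducedWord (w : Equiv.Perm (Fin n)) : wordProd (reducedWord w) = w :=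
  (exists_reduced_word w).choose_spec.1

@[simp] theorem length_reducedWord (w : Equiv.Perm (Fin n)) : (reducedWord w).length = len w :=
  (exists_reduced_word w).choose_spec.2

/-- The product of the `g_i` along a word depends only on the permutation if the word is
reduced. -/
theorem gw_eq_prod (l : List (Fin (n - 1))) (hl : l.length = len (wordProd l)) :
    gw r (wordProd l) = (l.map g).prod :=
  prod_map_eq_of_reduced g (fun _ _ => g_mul_g) (fun _ _ => g_braid) _ _
    (wordProd_reducedWord _) (by simp) (by simpa using hl)

theorem gw_mul {a b : Equiv.Perm (Fin n)} (h : len (a * b) = len a + len b) :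
    gw r (a * b) = gw r a * gw r b := by
  have := gw_eq_prod (r := r) (reducedWord a ++ reducedWord b) (by
    simp [wordProd_append, h])
  rwa [wordProd_append, List.map_append, List.prod_append, wordProd_reducedWord,
    wordProd_reducedWord] at this

@[simp] theorem gw_one : gw r (1 : Equiv.Perm (Fin n)) = 1 := by
  simpa using gw_eq_prod (r := r) (n := n) [] (by simp)

theorem gw_simple (i : Fin (n - 1)) : gw r (simple i) = g i := by
  simpa using gw_eq_prod (r := r) [i] (by simp [len_simple])

theorem gw_mul_simple {w : Equiv.Perm (Fin n)} {i : Fin (n - 1)} (h : w (lo i) < w (hi i)) :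
    gw r (w * simple i) = gw r w * g i := by
  rw [gw_mul (by rw [len_mul_simple h, len_simple]), gw_simple]

theorem gw_simple_mul {w : Equiv.Perm (Fin n)} {i : Fin (n - 1)} (h : w⁻¹ (lo i) < w⁻¹ (hi i)) :
    gw r (simple i * w) = g i * gw r w := by
  rw [gw_mul (by rw [len_simple_mul h, len_simple, add_comm]), gw_simple]

theorem gw_induction {P : Equiv.Perm (Fin n) → Prop} (one : P 1)
    (mul_simple : ∀ w i, w (lo i) < w (hi i) → P w → P (w * simple i))
    (w : Equiv.Perm (Fin n)) : P w :=
  rowStab_induction (ρ := fun _ => 0) (fun _ _ _ => le_rfl) one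
    (fun w _ i _ h => mul_simple w i h) w fun _ => rfl

end Relations

/-! ### Polynomials in the generators `t_j` -/

section Torus

variable {r n : ℕ}

open scoped IsMulCommutative in
/-- The substitution of the commuting elements `t_j` into polynomials. -/
def theta (r n : ℕ) : MvPolynomial (Fin n) (Base r) →ₐ[Base r] Y r n :=
  haveI : IsMulCommutative (Algebra.adjoin (Base r) (Set.range (t : Fin n → Y r n))) :=
    Algebra.isMulCommutative_adjoin (Base r) (by
      rintro _ ⟨i, rfl⟩ _ ⟨j, rfl⟩
      exact t_mul_t i j)
  (Algebra.adjoin (Base r) (Set.range (t : Fin n → Y r n))).val.comp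
    (MvPolynomial.aeval (R := Base r)
      (S₁ := Algebra.adjoin (Base r) (Set.range (t : Fin n → Y r n)))
      fun j => ⟨t j, Algebra.subset_adjoin ⟨j, rfl⟩⟩)

@[simp] theorem theta_X (j : Fin n) : theta r n (MvPolynomial.X j) = t j := by
  simp [theta]

@[simp] theorem theta_C (c : Base r) :
    theta r n (MvPolynomial.C c) = algebraMap (Base r) (Y r n) c :=
  (theta r n).commutes c

theorem gw_mul_theta (w : Equiv.Perm (Fin n)) (p : MvPolynomial (Fin n) (Base r)) :
    gw r w * theta r n p = theta r n (MvPolynomial.rename w p) * gw r w := by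
  induction w using gw_induction generalizing p with
  | one => simp
  | mul_simple w i h ih =>
    have hg : g i * theta r n p = theta r n (MvPolynomial.rename (simple i) p) * g i := by
      induction p using MvPolynomial.induction_on with
      | C a => simp [Algebra.commutes]
      | add p p' hp hp' => simp only [map_add, mul_add, add_mul, hp, hp']
      | mul_X p j hp =>
        rw [map_mul, ← mul_assoc, hp, mul_assoc, theta_X, g_mul_t, ← mul_assoc, map_mul, map_mul,
          MvPolynomial.rename_X, theta_X]
    rw [gw_mul_simple h, mul_assoc, hg, ← mul_assoc, ih, mul_assoc, MvPolynomial.rename_rename]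
    rfl

theorem e_eq_theta (i j : Fin n) :
    (e i j : Y r n) = theta r n (avg r (MvPolynomial.X i) (MvPolynomial.X j)) := by
  rw [map_avg, theta_X, theta_X, e]

theorem mul_theta_of_weight {z : Y r n} {χ : Fin n → Base r} (h : ∀ j, z * t j = χ j • z)
    (p : MvPolynomial (Fin n) (Base r)) : z * theta r n p = MvPolynomial.aeval χ p • z := by
  induction p using MvPolynomial.induction_on with
  | C a => rw [theta_C, ← Algebra.commutes, ← Algebra.smul_def]; simp
  | add p p' hp hp' => simp only [map_add, mul_add, add_smul, hp, hp']
  | mul_X p j hp =>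
    rw [map_mul, ← mul_assoc, hp, theta_X, smul_mul_assoc, h, smul_smul, map_mul,
      MvPolynomial.aeval_X]

end Torus

/-! ### The elements `U_μ` -/

section UElements

open MvPolynomial

variable {r n : ℕ}

/-- The polynomial behind `u_{i,k}`. -/
def uPoly (σ : Equiv.Perm (Fin r)) (i : Fin n) (k : Fin r) : MvPolynomial (Fin n) (Base r) :=
  ((List.finRange r).map fun l => if l ≠ k then X i - C (root σ l) else 1).prod

/-- The polynomial behind `u_μ`. -/
def uCompPoly (σ : Equiv.Perm (Fin r)) (μ : RComp r n) : MvPolynomial (Fin n) (Base r) :=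
  ((List.finRange r).map fun k =>
    if h : μ.type k ≠ 0 then uPoly σ (μ.lastPos k h) k else 1).prod

open Classical in
/-- The polynomial behind `E_I`. -/
def EIPoly (r : ℕ) (I : Finset (Fin n)) : MvPolynomial (Fin n) (Base r) :=
  ((List.finRange n).map fun i => ((List.finRange n).map fun j =>
    if i ∈ I ∧ j ∈ I ∧ i < j then avg r (X i) (X j) else 1).prod).prod

/-- The polynomial behind `E_{A_μ}`. -/
def EAPoly (μ : RComp r n) : MvPolynomial (Fin n) (Base r) :=
  ((List.finRange r).map fun k =>
    if μ.type k ≠ 0 then EIPoly r (interval μ.typeList n k) else 1).prod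

/-- The polynomial behind `U_μ`. -/
def UPoly (σ : Equiv.Perm (Fin r)) (μ : RComp r n) : MvPolynomial (Fin n) (Base r) :=
  uCompPoly σ μ * EAPoly μ

theorem theta_uPoly (σ : Equiv.Perm (Fin r)) (i : Fin n) (k : Fin r) :
    theta r n (uPoly σ i k) = u σ i k := by
  rw [uPoly, u, map_list_prod, List.map_map]
  congr 2
  funext l
  simp only [Function.comp]
  split_ifs
  · rw [map_sub, theta_X, theta_C]
  · rw [map_one]

theorem theta_EIPoly (I : Finset (Fin n)) : theta r n (EIPoly r I) = EI r I := by
  rw [EIPoly, EI, map_list_prod, List.map_map]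
  congr 2
  funext i
  simp only [Function.comp]
  rw [map_list_prod, List.map_map]
  congr 2
  funext j
  simp only [Function.comp]
  split_ifs
  · rw [e_eq_theta]
  · rw [map_one]

theorem theta_UPoly (σ : Equiv.Perm (Fin r)) (μ : RComp r n) :
    theta r n (UPoly σ μ) = U σ μ := by
  rw [UPoly, U, map_mul, uCompPoly, uComp, EAPoly, EA, map_list_prod, map_list_prod, List.map_map,
    List.map_map]
  congr 3
  · funext k
    simp only [Function.comp]
    split_ifs
    · rw [theta_uPoly]
    · rw [map_one]
  · funext k
    simp only [Function.comp]
    split_ifs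
    · rw [theta_EIPoly]
    · rw [map_one]

theorem uPoly_mul (hr : 1 ≤ r) (σ : Equiv.Perm (Fin r)) (i : Fin n) (k : Fin r) :
    uPoly σ i k * (X i - C (root σ k)) = X i ^ r - 1 := by
  have h := congrArg (Polynomial.aeval (X i : MvPolynomial (Fin n) (Base r)))
    (prod_X_sub_root hr σ)
  simp only [map_prod, map_sub, map_pow, map_one, Polynomial.aeval_X, Polynomial.aeval_C] at h
  rw [uPoly, ← Fin.prod_univ_def, Finset.prod_ite, Finset.prod_const_one, mul_one,
    Finset.filter_ne']
  exact (Finset.prod_erase_mul _ (fun l => X i - C (root σ l)) (Finset.mem_univ k)).trans h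

/-- The reason for lifting `U σ μ` to a polynomial: a single factor can be isolated by divisibility
in a commutative ring. -/
theorem theta_mul_eq_zero {p p' s : MvPolynomial (Fin n) (Base r)} (h : p ∣ p')
    (h0 : theta r n (p * s) = 0) : theta r n (p' * s) = 0 := by
  obtain ⟨c, rfl⟩ := h
  rw [mul_right_comm, map_mul, h0, zero_mul]

theorem RComp.type_color_ne_zero (μ : RComp r n) (j : Fin n) : μ.type (μ.color j) ≠ 0 := by
  rw [← μ.card_color]
  exact Finset.card_ne_zero_of_mem (a := j) (by simp)

theorem RComp.color_lastPos (μ : RComp r n) (k : Fin r) (h : μ.type k ≠ 0) :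
    μ.color (μ.lastPos k h) = k := by
  rw [← μ.mem_interval_typeList]
  have hk : (k : ℕ) < μ.typeList.length := by simp [RComp.typeList]
  have h1 : (μ.typeList.take (k + 1)).sum = (μ.typeList.take k).sum + μ.type k := by
    rw [List.take_succ_eq_append_getElem hk, List.sum_append, List.sum_singleton]
    simp [RComp.typeList]
  simp only [interval, RComp.lastPos, Finset.mem_filter, Finset.mem_univ, true_and]
  omega

theorem RComp.le_lastPos (μ : RComp r n) (j : Fin n) :
    j ≤ μ.lastPos (μ.color j) (μ.type_color_ne_zero j) := by
  have := (μ.mem_interval_typeList j _).2 rfl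
  simp only [interval, Finset.mem_filter, Finset.mem_univ, true_and] at this
  rw [Fin.le_def, RComp.lastPos]
  simp only
  omega

theorem uPoly_dvd (σ : Equiv.Perm (Fin r)) (μ : RComp r n) (k : Fin r) (h : μ.type k ≠ 0) :
    uPoly σ (μ.lastPos k h) k ∣ UPoly σ μ := by
  refine Dvd.dvd.mul_right (List.dvd_prod (List.mem_map.2 ⟨k, List.mem_finRange k, ?_⟩)) _
  rw [dif_pos h]

theorem avg_dvd (σ : Equiv.Perm (Fin r)) (μ : RComp r n) {i j : Fin n} (hij : i < j)
    (h : μ.color i = μ.color j) : avg r (X i) (X j) ∣ UPoly σ μ := by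
  have h1 : EIPoly r (interval μ.typeList n (μ.color j)) ∣ UPoly σ μ := by
    refine Dvd.dvd.mul_left (List.dvd_prod
      (List.mem_map.2 ⟨μ.color j, List.mem_finRange _, ?_⟩)) _
    rw [if_pos (μ.type_color_ne_zero j)]
  refine Dvd.dvd.trans ?_ h1
  refine Dvd.dvd.trans ?_ (List.dvd_prod (List.mem_map.2 ⟨i, List.mem_finRange i, rfl⟩))
  refine List.dvd_prod (List.mem_map.2 ⟨j, List.mem_finRange j, if_pos ⟨?_, ?_, hij⟩⟩)
  · exact (μ.mem_interval_typeList i _).2 h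
  · exact (μ.mem_interval_typeList j _).2 rfl

/-- The factor `uPoly σ a k` fixes the eigenvalue of `t_a` for the last letter `a` of the component,
since `t_a ^ r = 1`. The factor `e_{j,a}` carries it to every other letter `j` of that component. -/
theorem U_mul_t (hr : 1 ≤ r) (σ : Equiv.Perm (Fin r)) (μ : RComp r n) (j : Fin n) :
    U σ μ * t j = root σ (μ.color j) • U σ μ := by
  set a := μ.lastPos (μ.color j) (μ.type_color_ne_zero j) with ha
  have h1 : theta r n (UPoly σ μ * (X a - C (root σ (μ.color j)))) = 0 := by
    refine theta_mul_eq_zero (uPoly_dvd σ μ _ (μ.type_color_ne_zero j)) ?_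
    rw [uPoly_mul hr, map_sub, map_pow, theta_X, map_one, t_pow, sub_self]
  have h2 : theta r n (UPoly σ μ * (X j - X a)) = 0 := by
    rcases (μ.le_lastPos j).lt_or_eq with h | h
    · refine theta_mul_eq_zero (avg_dvd σ μ h (μ.color_lastPos _ _).symm) ?_
      rw [avg_mul_sub, map_smul, map_mul, map_sub, map_pow, map_pow, theta_X, theta_X, t_pow,
        t_pow, sub_self, mul_zero, smul_zero]
    · rw [ha, ← h, sub_self, mul_zero, map_zero]
  have h3 : theta r n (UPoly σ μ * (X j - C (root σ (μ.color j)))) = 0 := by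
    rw [← sub_add_sub_cancel (X j) (X a), mul_add, map_add, h1, h2, add_zero]
  rw [map_mul, theta_UPoly, map_sub, theta_X, theta_C, mul_sub, sub_eq_zero] at h3
  rw [h3, ← Algebra.commutes, Algebra.smul_def]

/-- The scalar by which `U_μ` acts on vectors of its own weight. -/
def UScalar (σ : Equiv.Perm (Fin r)) (μ : RComp r n) : Base r :=
  aeval (fun j => root σ (μ.color j)) (UPoly σ μ)

/-- At this weight the linear factors become differences of distinct roots of unity and the averages
become 1. -/
theorem UScalar_ne_zero (hr : 1 ≤ r) (σ : Equiv.Perm (Fin r)) (μ : RComp r n) :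
    UScalar σ μ ≠ 0 := by
  have hprod : ∀ {ι : Type} (L : List ι) (f : ι → MvPolynomial (Fin n) (Base r)),
      (∀ i, aeval (fun j => root σ (μ.color j)) (f i) ≠ 0) →
      aeval (fun j => root σ (μ.color j)) (L.map f).prod ≠ 0 := by
    intro ι L f h
    rw [map_list_prod, List.map_map]
    refine List.prod_ne_zero fun h0 => ?_
    obtain ⟨i, -, hi⟩ := List.mem_map.1 h0
    exact h i hi
  rw [UScalar, UPoly, map_mul]
  refine mul_ne_zero (hprod _ _ fun k => ?_) (hprod _ _ fun k => ?_)
  · split_ifs with h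
    · refine hprod _ _ fun l => ?_
      split_ifs with hl
      · rw [map_sub, aeval_X, aeval_C, μ.color_lastPos]
        exact sub_ne_zero.2 fun h' => hl (root_injective hr σ h').symm
      · rw [map_one]; exact one_ne_zero
    · rw [map_one]; exact one_ne_zero
  · split_ifs with h
    · refine hprod _ _ fun i => hprod _ _ fun j => ?_
      split_ifs with hij
      · rw [μ.mem_interval_typeList, μ.mem_interval_typeList] at hij
        rw [map_avg, aeval_X, aeval_X, avg_root hr, if_pos (hij.1.trans hij.2.1.symm)]
        exact one_ne_zero
      · rw [map_one]; exact one_ne_zero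
    · rw [map_one]; exact one_ne_zero

/-- The polynomial behind the primitive idempotent of the torus of weight `κ`. -/
def idemPoly (σ : Equiv.Perm (Fin r)) (κ : Fin n → Fin r) : MvPolynomial (Fin n) (Base r) :=
  ∏ j, avg r (X j) (C (root σ (κ j)))

theorem theta_idemPoly_mul_t (hr : 1 ≤ r) (σ : Equiv.Perm (Fin r)) (κ : Fin n → Fin r)
    (j : Fin n) :
    theta r n (idemPoly σ κ) * t j = root σ (κ j) • theta r n (idemPoly σ κ) := by
  have h := theta_mul_eq_zero (s := X j - C (root σ (κ j)))
    (Finset.dvd_prod_of_mem (fun j => avg r (X j : MvPolynomial (Fin n) (Base r))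
      (C (root σ (κ j)))) (Finset.mem_univ j)) (by
    rw [avg_mul_sub, map_smul, map_mul, map_sub, map_pow, map_pow, theta_X, t_pow, theta_C,
      ← map_pow, root_pow hr, map_one, sub_self, mul_zero, smul_zero])
  rw [map_mul, map_sub, theta_X, theta_C, mul_sub, sub_eq_zero] at h
  rw [idemPoly, h, ← Algebra.commutes, Algebra.smul_def]

/-- Both elements are eigenvectors of the same weight, so their product can be evaluated in two
ways. Unlike `U σ μ`, the idempotent singles out no letter, so its invariance under `μ.Sα` is
visible. -/
theorem U_eq_smul_theta (hr : 1 ≤ r) (σ : Equiv.Perm (Fin r)) (μ : RComp r n) :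
    U σ μ = UScalar σ μ • theta r n (idemPoly σ μ.color) := by
  have h1 := mul_theta_of_weight (U_mul_t hr σ μ) (idemPoly σ μ.color)
  have h2 := mul_theta_of_weight (theta_idemPoly_mul_t hr σ μ.color) (UPoly σ μ)
  have h3 : aeval (fun j => root σ (μ.color j)) (idemPoly σ μ.color) = 1 := by
    rw [idemPoly, map_prod]
    refine Finset.prod_eq_one fun j _ => ?_
    rw [map_avg, aeval_X, aeval_C, Algebra.algebraMap_self_apply, avg_root hr, if_pos rfl]
  rw [h3, one_smul] at h1
  rw [UScalar, ← h2, ← h1, ← theta_UPoly, ← map_mul, ← map_mul, mul_comm]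

theorem gw_mul_U (hr : 1 ≤ r) (σ : Equiv.Perm (Fin r)) (μ : RComp r n) {w : Equiv.Perm (Fin n)}
    (hw : w ∈ μ.Sα) : gw r w * U σ μ = U σ μ * gw r w := by
  have h : rename w (idemPoly σ μ.color) = idemPoly σ μ.color := by
    rw [idemPoly, map_prod]
    conv_rhs => rw [← Equiv.prod_comp w]
    refine Finset.prod_congr rfl fun j _ => ?_
    rw [map_avg, rename_X, rename_C, μ.mem_Sα.1 hw]
  rw [U_eq_smul_theta hr, mul_smul_comm, gw_mul_theta, h, smul_mul_assoc]

theorem U_mul_e (hr : 1 ≤ r) (σ : Equiv.Perm (Fin r)) (μ : RComp r n) (i j : Fin n) :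
    U σ μ * e i j = (if μ.color i = μ.color j then 1 else 0 : Base r) • U σ μ := by
  rw [e_eq_theta, mul_theta_of_weight (U_mul_t hr σ μ), map_avg, aeval_X, aeval_X, avg_root hr]

theorem U_mul_gw_mul_t (hr : 1 ≤ r) (σ : Equiv.Perm (Fin r)) (μ : RComp r n)
    (w : Equiv.Perm (Fin n)) (j : Fin n) :
    U σ μ * gw r w * t j = root σ (μ.color (w j)) • (U σ μ * gw r w) := by
  rw [mul_assoc, ← theta_X, gw_mul_theta, rename_X, theta_X, ← mul_assoc, U_mul_t hr,
    smul_mul_assoc]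

theorem U_congr (σ : Equiv.Perm (Fin r)) {μ ν : RComp r n} (h : μ.type = ν.type) :
    U σ μ = U σ ν := by
  simp only [U, uComp, EA, RComp.lastPos, RComp.typeList_congr h, h]

end UElements

/-! ### The representation on functions on the symmetric group -/

section Representation

open MvPolynomial MulOpposite

variable {r n : ℕ}

/-- The diagonal coefficient of the action of a generator `g_i`. -/
def diagCoeff (κ : Fin n → Fin r) (a b : Fin n) : Base r :=
  if b < a ∧ κ a = κ b then q r - qinv r else 0

/-- The right action of `g_i` on coefficient functions. -/
def opG (κ : Fin n → Fin r) (i : Fin (n - 1)) :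
    Module.End (Base r) (Equiv.Perm (Fin n) → Base r) where
  toFun F w := F (w * simple i) + diagCoeff κ (w (lo i)) (w (hi i)) * F w
  map_add' F F' := by
    funext w
    simp only [Pi.add_apply]
    ring
  map_smul' c F := by
    funext w
    simp only [Pi.smul_apply, smul_eq_mul, RingHom.id_apply]
    ring

theorem opG_apply (κ : Fin n → Fin r) (i : Fin (n - 1)) (F : Equiv.Perm (Fin n) → Base r)
    (w : Equiv.Perm (Fin n)) :
    opG κ i F w = F (w * simple i) + diagCoeff κ (w (lo i)) (w (hi i)) * F w := rfl

/-- Functions on the symmetric group acting by multiplication. -/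
def diag (r n : ℕ) : (Equiv.Perm (Fin n) → Base r) →ₐ[Base r]
    (Module.End (Base r) (Equiv.Perm (Fin n) → Base r))ᵐᵒᵖ :=
  (Algebra.lmul (Base r) (Equiv.Perm (Fin n) → Base r)).toOpposite fun a b => by
    rw [Commute, SemiconjBy, ← map_mul, ← map_mul, mul_comm]

theorem unop_diag_apply (a F : Equiv.Perm (Fin n) → Base r) : unop (diag r n a) F = a * F := rfl

theorem opG_comm (κ : Fin n → Fin r) {i j : Fin (n - 1)}
    (h : (i : ℕ) + 2 ≤ j ∨ (j : ℕ) + 2 ≤ i) : opG κ i * opG κ j = opG κ j * opG κ i := by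
  have hs : simple i * simple j = simple j * simple i := by
    rcases h with h | h
    · exact simple_comm h
    · exact (simple_comm h).symm
  refine LinearMap.ext fun F => funext fun w => ?_
  simp only [Module.End.mul_apply, opG_apply, Equiv.Perm.mul_apply, simple_lo_of_far h,
    simple_hi_of_far h, simple_lo_of_far h.symm, simple_hi_of_far h.symm, mul_assoc w, hs]
  ring

/-- With `a`, `b`, `c` the values of `w` at three consecutive letters, these compare the
coefficients of `F (w * simple i)`, `F (w * simple j)` and `F w` in the braid relation. -/
theorem diagCoeff_braid (κ : Fin n → Fin r) {a b c : Fin n} (hab : a ≠ b) (hac : a ≠ c)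
    (hbc : b ≠ c) :
    diagCoeff κ a c * diagCoeff κ b a + diagCoeff κ a b * diagCoeff κ b c =
        diagCoeff κ b c * diagCoeff κ a c ∧
      diagCoeff κ a b * diagCoeff κ a c =
        diagCoeff κ a b * diagCoeff κ b c + diagCoeff κ a c * diagCoeff κ c b ∧
      diagCoeff κ a b * diagCoeff κ b c * diagCoeff κ a b =
        diagCoeff κ b c * diagCoeff κ a b * diagCoeff κ b c := by
  rcases lt_or_gt_of_ne hab with h1 | h1 <;> rcases lt_or_gt_of_ne hac with h2 | h2 <;>
    rcases lt_or_gt_of_ne hbc with h3 | h3 <;>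
    by_cases k1 : κ a = κ b <;> by_cases k2 : κ b = κ c <;>
    simp_all [diagCoeff, h1.not_gt, h2.not_gt, h3.not_gt, eq_comm]
  -- What remains are the two cyclic, hence impossible, orderings of `a`, `b`, `c`.
  all_goals first | exact absurd (h1.trans (h3.trans h2)) (lt_irrefl _) | skip
  all_goals exact absurd (h2.trans (h3.trans h1)) (lt_irrefl _)

theorem opG_braid (κ : Fin n → Fin r) {i j : Fin (n - 1)} (h : (j : ℕ) = i + 1) :
    opG κ i * opG κ j * opG κ i = opG κ j * opG κ i * opG κ j := by
  refine LinearMap.ext fun F => funext fun w => ?_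
  have hbraid : w * simple j * simple i * simple j = w * simple i * simple j * simple i := by
    rw [mul_assoc w, mul_assoc w, ← simple_braid h, ← mul_assoc, ← mul_assoc]
  obtain ⟨h1, h2, h3⟩ := diagCoeff_braid κ (a := w (lo i)) (b := w (hi i)) (c := w (hi j))
    (apply_lo_ne_apply_hi w i)
    (fun h' => ((lo_lt_hi i).trans_eq (hi_eq_lo h)).trans (lo_lt_hi j) |>.ne (w.injective h'))
    (by rw [hi_eq_lo h]; exact apply_lo_ne_apply_hi w j)
  simp only [Module.End.mul_apply, opG_apply, Equiv.Perm.mul_apply, ← hi_eq_lo h, simple_lo,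
    simple_hi, simple_hi_succ h, simple_succ_lo h, mul_simple_mul_simple, hbraid]
  have e1 : simple j (hi i) = hi j := by rw [hi_eq_lo h, simple_lo]
  simp only [e1, simple_hi_succ h]
  linear_combination F (w * simple i) * h1 + F (w * simple j) * h2 + F w * h3

theorem diagCoeff_mul_root (σ : Equiv.Perm (Fin r)) (κ : Fin n → Fin r) (w : Equiv.Perm (Fin n))
    (i : Fin (n - 1)) (j : Fin n) :
    diagCoeff κ (w (lo i)) (w (hi i)) * root σ (κ (w (simple i j))) =
      diagCoeff κ (w (lo i)) (w (hi i)) * root σ (κ (w j)) := by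
  rw [diagCoeff]
  split_ifs with h
  · congr 2
    rw [simple, Equiv.swap_apply_def]
    split_ifs with h1 h2
    · rw [h1, h.2]
    · rw [h2, h.2]
    · rfl
  · rw [zero_mul, zero_mul]

/-- The right action of the Yokonuma-Hecke algebra on coefficient functions. -/
def rep (hr : 1 ≤ r) (σ : Equiv.Perm (Fin r)) (κ : Fin n → Fin r) :
    Y r n →ₐ[Base r] (Module.End (Base r) (Equiv.Perm (Fin n) → Base r))ᵐᵒᵖ :=
  RingQuot.liftAlgHom (Base r) ⟨FreeAlgebra.lift (Base r)
    (Sum.elim (fun j => diag r n fun w => root σ (κ (w j))) fun i => op (opG κ i)), by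
    intro x y hxy
    induction hxy with
    | comm_g i j h =>
      simp only [fg, map_mul, FreeAlgebra.lift_ι_apply, Sum.elim_inr, ← op_mul, opG_comm κ h]
    | braid i j h =>
      simp only [fg, map_mul, FreeAlgebra.lift_ι_apply, Sum.elim_inr, ← op_mul, ← mul_assoc,
        opG_braid κ h]
    | comm_t i j =>
      rw [ft, ft, map_mul, map_mul, FreeAlgebra.lift_ι_apply, FreeAlgebra.lift_ι_apply,
        Sum.elim_inl, Sum.elim_inl, ← map_mul, ← map_mul, mul_comm]
    | g_t i j =>
      simp only [fg, ft, map_mul, FreeAlgebra.lift_ι_apply, Sum.elim_inl, Sum.elim_inr]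
      apply unop_injective
      refine LinearMap.ext fun F => funext fun w => ?_
      simp only [unop_mul, unop_op, Module.End.mul_apply, unop_diag_apply, opG_apply, Pi.mul_apply,
        Equiv.Perm.mul_apply, simple_simple]
      rw [mul_add, mul_left_comm _ (diagCoeff _ _ _), ← mul_assoc (diagCoeff _ _ _),
        ← mul_assoc (diagCoeff _ _ _), diagCoeff_mul_root]
    | t_pow j =>
      simp only [ft, map_pow, map_one, FreeAlgebra.lift_ι_apply, Sum.elim_inl]
      rw [← map_pow, ← map_one (diag r n)]
      congr 1
      funext w
      exact root_pow hr σ _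
    | g_sq i =>
      have hav : ∀ w : Equiv.Perm (Fin n),
          (avg r (fun w : Equiv.Perm (Fin n) => root σ (κ (w (lo i))))
            (fun w => root σ (κ (w (hi i))))) w =
          if κ (w (lo i)) = κ (w (hi i)) then 1 else 0 := fun w => by
        rw [← avg_root hr σ]
        exact map_avg (Pi.evalAlgHom (Base r) (fun _ => Base r) w) _ _
      simp only [ft, fg, map_pow, map_mul, map_add, map_smul, map_one, map_avg,
        FreeAlgebra.lift_ι_apply, Sum.elim_inl, Sum.elim_inr]
      rw [← map_avg]
      apply unop_injective
      refine LinearMap.ext fun F => funext fun w => ?_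
      simp only [pow_two, unop_mul, unop_op, unop_add, unop_smul, unop_one, Module.End.mul_apply,
        LinearMap.add_apply, LinearMap.smul_apply, Module.End.one_apply, unop_diag_apply,
        opG_apply, Pi.mul_apply, Pi.add_apply, Pi.smul_apply, hav, Equiv.Perm.mul_apply, simple_lo,
        simple_hi, mul_simple_mul_simple, smul_eq_mul]
      rcases lt_or_gt_of_ne (apply_lo_ne_apply_hi w i) with h | h <;>
        by_cases hk : κ (w (lo i)) = κ (w (hi i)) <;>
        simp [diagCoeff, h, h.not_gt, hk, eq_comm]
      exact fun h' => absurd h'.symm hk⟩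

theorem rep_t (hr : 1 ≤ r) (σ : Equiv.Perm (Fin r)) (κ : Fin n → Fin r) (j : Fin n) :
    rep hr σ κ (t j) = diag r n fun w => root σ (κ (w j)) :=
  (RingQuot.liftAlgHom_mkAlgHom_apply (Base r) _ _ _).trans (FreeAlgebra.lift_ι_apply _ _)

theorem rep_g (hr : 1 ≤ r) (σ : Equiv.Perm (Fin r)) (κ : Fin n → Fin r) (i : Fin (n - 1)) :
    rep hr σ κ (g i) = op (opG κ i) :=
  (RingQuot.liftAlgHom_mkAlgHom_apply (Base r) _ _ _).trans (FreeAlgebra.lift_ι_apply _ _)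

theorem rep_theta (hr : 1 ≤ r) (σ : Equiv.Perm (Fin r)) (κ : Fin n → Fin r)
    (p : MvPolynomial (Fin n) (Base r)) :
    rep hr σ κ (theta r n p) =
      diag r n (aeval (fun j (w : Equiv.Perm (Fin n)) => root σ (κ (w j))) p) := by
  have : (rep hr σ κ).comp (theta r n) =
      (diag r n).comp (aeval fun j (w : Equiv.Perm (Fin n)) => root σ (κ (w j))) := by
    refine MvPolynomial.algHom_ext fun j => ?_
    simp [rep_t]
  exact DFunLike.congr_fun this p

/-- As long as the length increases, the diagonal coefficient vanishes and the delta function is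
merely translated. -/
theorem rep_gw_single (hr : 1 ≤ r) (σ : Equiv.Perm (Fin r)) (κ : Fin n → Fin r)
    (w : Equiv.Perm (Fin n)) :
    unop (rep hr σ κ (gw r w)) (Pi.single 1 1) = Pi.single w 1 := by
  induction w using gw_induction with
  | one => rw [gw_one, map_one]; rfl
  | mul_simple w i h ih =>
    rw [gw_mul_simple h, map_mul, unop_mul, Module.End.mul_apply, ih, rep_g, unop_op]
    funext v
    rw [opG_apply]
    by_cases hv : v = w
    · subst hv
      have h1 : v * simple i ≠ v := fun h' => by
        have := len_mul_simple h
        rw [h'] at this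
        omega
      simp [diagCoeff, h.not_gt, h1, h1.symm]
    · by_cases hv' : v = w * simple i
      · subst hv'
        simp [hv]
      · have h1 : v * simple i ≠ w := fun h' => hv' (by rw [← h', mul_simple_mul_simple])
        simp [hv, hv', h1]

theorem rep_U_single (hr : 1 ≤ r) (σ : Equiv.Perm (Fin r)) (μ : RComp r n) :
    unop (rep hr σ μ.color (U σ μ)) (Pi.single 1 1) = UScalar σ μ • Pi.single 1 1 := by
  rw [← theta_UPoly, rep_theta, unop_diag_apply]
  funext v
  by_cases hv : v = 1
  · subst hv
    have h : (aeval (fun j (w : Equiv.Perm (Fin n)) => root σ (μ.color (w j))) (UPoly σ μ)) 1 =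
        UScalar σ μ := by
      have : (Pi.evalAlgHom (Base r) (fun _ : Equiv.Perm (Fin n) => Base r) 1).comp
          (aeval fun j (w : Equiv.Perm (Fin n)) => root σ (μ.color (w j))) =
          aeval fun j => root σ (μ.color j) := by
        refine MvPolynomial.algHom_ext fun j => ?_
        simp
      exact DFunLike.congr_fun this (UPoly σ μ)
    simp [h]
  · simp [hv]

/-! ### Coefficient functions for the right ideal generated by `U_μ`. -/

/-- The linear combination of the elements `U_μ g_w` with given coefficients. -/
def comb (σ : Equiv.Perm (Fin r)) (μ : RComp r n) :
    (Equiv.Perm (Fin n) → Base r) →ₗ[Base r] Y r n :=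
  Fintype.linearCombination (Base r) fun w => U σ μ * gw r w

theorem comb_apply (σ : Equiv.Perm (Fin r)) (μ : RComp r n) (F : Equiv.Perm (Fin n) → Base r) :
    comb σ μ F = ∑ w, F w • (U σ μ * gw r w) := rfl

theorem comb_single (σ : Equiv.Perm (Fin r)) (μ : RComp r n) :
    comb σ μ (Pi.single 1 1) = U σ μ := by
  rw [comb, Fintype.linearCombination_apply_single, one_smul, gw_one, mul_one]

/-- Letting `comb σ μ F` act on the delta function at 1 returns `F` times a nonzero scalar, so no
basis of the whole algebra is needed. -/
theorem comb_injective (hr : 1 ≤ r) (σ : Equiv.Perm (Fin r)) (μ : RComp r n) :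
    Function.Injective (comb σ μ) := by
  have key : ∀ F, unop (rep hr σ μ.color (comb σ μ F)) (Pi.single 1 1) = UScalar σ μ • F := by
    intro F
    rw [comb_apply, map_sum, Finset.unop_sum, LinearMap.sum_apply]
    simp only [map_smul, unop_smul, LinearMap.smul_apply, map_mul, unop_mul, Module.End.mul_apply,
      rep_U_single, rep_gw_single]
    funext v
    simp [Finset.sum_apply, Pi.single_apply, mul_comm]
  rw [injective_iff_map_eq_zero]
  intro F hF
  have := key F
  rw [hF, map_zero, unop_zero, LinearMap.zero_apply] at this
  exact (smul_eq_zero.1 this.symm).resolve_left (UScalar_ne_zero hr σ μ)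

/-- If `w * simple i` is shorter, the quadratic relation applies. Its idempotent, moved left past
`gw r (w * simple i)`, is evaluated by `U σ μ` to 1 or 0 according to whether two colors agree; this
is the origin of `diagCoeff`. -/
theorem U_mul_gw_mul_g (hr : 1 ≤ r) (σ : Equiv.Perm (Fin r)) (μ : RComp r n)
    (w : Equiv.Perm (Fin n)) (i : Fin (n - 1)) :
    U σ μ * gw r w * g i = U σ μ * gw r (w * simple i) +
      diagCoeff μ.color (w (lo i)) (w (hi i)) • (U σ μ * gw r w) := by
  rcases lt_or_gt_of_ne (apply_lo_ne_apply_hi w i) with h | h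
  · rw [gw_mul_simple h, diagCoeff, if_neg fun h' => h'.1.not_gt h, zero_smul, add_zero, mul_assoc]
  · have h' := gw_mul_simple (r := r) (w := w * simple i) (i := i) (by simpa using h)
    rw [mul_simple_mul_simple] at h'
    have he : U σ μ * gw r (w * simple i) * e (lo i) (hi i) =
        (if μ.color (w (lo i)) = μ.color (w (hi i)) then 1 else 0 : Base r) •
          (U σ μ * gw r (w * simple i)) := by
      rw [mul_assoc, e_eq_theta, gw_mul_theta, map_avg, rename_X, rename_X, ← e_eq_theta,
        ← mul_assoc, U_mul_e hr, smul_mul_assoc]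
      simp [eq_comm]
    rw [h', mul_assoc, mul_assoc, g_mul_self, mul_add, mul_add, mul_one, mul_smul_comm,
      mul_smul_comm, ← mul_assoc (gw r _) (e _ _), ← mul_assoc (U σ μ), ← mul_assoc (U σ μ),
      he, smul_mul_assoc, smul_smul, mul_assoc, diagCoeff]
    congr 2
    simp [h]

theorem comb_mul (hr : 1 ≤ r) (σ : Equiv.Perm (Fin r)) (μ : RComp r n) (h : Y r n)
    (F : Equiv.Perm (Fin n) → Base r) :
    comb σ μ F * h = comb σ μ (unop (rep hr σ μ.color h) F) := by
  induction h using Y_induction generalizing F with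
  | algebraMap c =>
    rw [AlgHom.commutes, ← Algebra.commutes, ← Algebra.smul_def, ← map_smul]
    rfl
  | t j =>
    simp only [rep_t, unop_diag_apply, comb_apply, Finset.sum_mul, smul_mul_assoc, Pi.mul_apply,
      U_mul_gw_mul_t hr, smul_smul, mul_comm]
  | g i =>
    simp only [rep_g, unop_op, comb_apply, Finset.sum_mul, smul_mul_assoc, opG_apply,
      U_mul_gw_mul_g hr, smul_add, add_smul, Finset.sum_add_distrib, smul_smul, mul_comm]
    congr 1
    rw [← Equiv.sum_comp (Equiv.mulRight (simple i))]
    simp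
  | add a b ha hb => rw [mul_add, ha, hb, map_add, unop_add, LinearMap.add_apply, map_add]
  | mul a b ha hb => rw [← mul_assoc, ha, hb, map_mul, unop_mul, Module.End.mul_apply]

theorem exists_comb_eq (hr : 1 ≤ r) (σ : Equiv.Perm (Fin r)) (μ : RComp r n) (h : Y r n) :
    ∃ F, comb σ μ F = U σ μ * h :=
  ⟨_, by rw [← comb_single, comb_mul hr]⟩

end Representation

/-! ### Homomorphisms between the modules `M^μ` -/

section Homs

open MulOpposite

variable {r n : ℕ}

open Classical in
/-- The coefficient function of `∑_{w ∈ C} q^{l(w)} U_μ g_w`. -/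
def qInd (r : ℕ) (C : Set (Equiv.Perm (Fin n))) (w : Equiv.Perm (Fin n)) : Base r :=
  if w ∈ C then q r ^ len w else 0

theorem qInd_of_mem {C : Set (Equiv.Perm (Fin n))} {w : Equiv.Perm (Fin n)} (h : w ∈ C) :
    qInd r C w = q r ^ len w := if_pos h

theorem qInd_of_notMem {C : Set (Equiv.Perm (Fin n))} {w : Equiv.Perm (Fin n)} (h : w ∉ C) :
    qInd r C w = 0 := if_neg h

open Classical in
theorem comb_qInd (σ : Equiv.Perm (Fin r)) (μ : RComp r n) (C : Set (Equiv.Perm (Fin n))) :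
    comb σ μ (qInd r C) = ∑ w with w ∈ C, q r ^ len w • (U σ μ * gw r w) := by
  rw [comb_apply, Finset.sum_filter]
  refine Finset.sum_congr rfl fun w _ => ?_
  rw [qInd]
  split_ifs
  · rfl
  · rw [zero_smul]

theorem m_eq_comb (σ : Equiv.Perm (Fin r)) (μ : RComp r n) :
    m σ μ = comb σ μ (qInd r (μ.S : Set (Equiv.Perm (Fin n)))) := by
  classical
  rw [comb_qInd, m, x, Finset.mul_sum]
  simp only [mul_smul_comm, SetLike.mem_coe]

/-- Within a component `g i` commutes with `U σ μ`, and the idempotent of the quadratic relation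
acts as 1, so the formula is that of the ordinary Hecke algebra. -/
theorem g_mul_comb (hr : 1 ≤ r) (σ : Equiv.Perm (Fin r)) (μ : RComp r n) {i : Fin (n - 1)}
    (hi' : μ.color (lo i) = μ.color (hi i)) (F : Equiv.Perm (Fin n) → Base r) :
    g i * comb σ μ F = comb σ μ fun w => F (simple i * w) +
      (if w⁻¹ (hi i) < w⁻¹ (lo i) then q r - qinv r else 0) * F w := by
  have hs : simple i ∈ μ.Sα := by
    rw [RComp.Sα_eq]
    exact simple_mem_rowStab (congrArg Fin.val hi')
  have hgU : g i * U σ μ = U σ μ * g i := by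
    rw [← gw_simple, gw_mul_U hr σ μ hs]
  have key : ∀ w : Equiv.Perm (Fin n), g i * (U σ μ * gw r w) = U σ μ * gw r (simple i * w) +
      (if w⁻¹ (hi i) < w⁻¹ (lo i) then q r - qinv r else 0 : Base r) • (U σ μ * gw r w) := by
    intro w
    rw [← mul_assoc, hgU, mul_assoc]
    rcases lt_or_gt_of_ne (apply_lo_ne_apply_hi w⁻¹ i) with h | h
    · rw [gw_simple_mul h, if_neg h.not_gt, zero_smul, add_zero]
    · have h' := gw_simple_mul (r := r) (w := simple i * w) (i := i) (by simpa using h)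
      rw [simple_mul_simple_mul] at h'
      rw [if_pos h, h', ← mul_assoc (g i), g_mul_self, add_mul, one_mul, mul_add, smul_mul_assoc,
        mul_smul_comm, ← mul_assoc (U σ μ) (e _ _ * _), ← mul_assoc (U σ μ) (e _ _), U_mul_e hr,
        if_pos hi', one_smul, mul_assoc (U σ μ) (g i)]
  simp only [comb_apply, Finset.mul_sum, mul_smul_comm, key, smul_add, add_smul,
    Finset.sum_add_distrib, smul_smul, mul_comm]
  congr 1
  rw [← Equiv.sum_comp (Equiv.mulLeft (simple i))]
  simp

/-! ### The generator `m_μ` as a simultaneous eigenvector. -/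

theorem q_pow_step (k : ℕ) :
    q r ^ k + (q r - qinv r) * q r ^ (k + 1) = q r * q r ^ (k + 1) := by
  have := q_mul_qinv r
  linear_combination (-q r ^ k) * this

theorem m_mul_g (hr : 1 ≤ r) (σ : Equiv.Perm (Fin r)) (μ : RComp r n) {i : Fin (n - 1)}
    (hi' : μ.row (lo i) = μ.row (hi i)) : m σ μ * g i = q r • m σ μ := by
  have hs : simple i ∈ μ.S := by
    rw [μ.S_eq]; exact simple_mem_rowStab hi'
  rw [m_eq_comb, comb_mul hr, ← map_smul]
  congr 1
  funext w
  rw [rep_g, unop_op, opG_apply, Pi.smul_apply, smul_eq_mul]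
  by_cases hw : w ∈ μ.S
  · rw [qInd_of_mem (show w * simple i ∈ (μ.S : Set _) from mul_mem hw hs),
      qInd_of_mem (show w ∈ (μ.S : Set _) from hw), diagCoeff]
    rcases lt_or_gt_of_ne (apply_lo_ne_apply_hi w i) with h | h
    · rw [if_neg fun h' => h'.1.not_gt h, len_mul_simple h, zero_mul, add_zero, pow_succ']
    · have hc := μ.mem_Sα.1 (μ.S_le_Sα hw)
      rw [if_pos ⟨h, by rw [hc, hc, μ.color_eq_of_row_eq hi']⟩, len_mul_simple_of_gt h, q_pow_step]
  · rw [qInd_of_notMem (show w * simple i ∉ (μ.S : Set _) from fun h =>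
      hw ((mul_mem_cancel_right hs).1 h)), qInd_of_notMem hw, mul_zero, mul_zero, add_zero]

theorem g_mul_m (hr : 1 ≤ r) (σ : Equiv.Perm (Fin r)) (μ : RComp r n) {i : Fin (n - 1)}
    (hi' : μ.row (lo i) = μ.row (hi i)) : g i * m σ μ = q r • m σ μ := by
  have hs : simple i ∈ μ.S := by
    rw [μ.S_eq]; exact simple_mem_rowStab hi'
  rw [m_eq_comb, g_mul_comb hr σ μ (μ.color_eq_of_row_eq hi'), ← map_smul]
  congr 1
  funext w
  rw [Pi.smul_apply, smul_eq_mul]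
  by_cases hw : w ∈ μ.S
  · rw [qInd_of_mem (show simple i * w ∈ (μ.S : Set _) from mul_mem hs hw),
      qInd_of_mem (show w ∈ (μ.S : Set _) from hw)]
    rcases lt_or_gt_of_ne (apply_lo_ne_apply_hi w⁻¹ i) with h | h
    · rw [if_neg h.not_gt, len_simple_mul h, zero_mul, add_zero, pow_succ']
    · rw [if_pos h, len_simple_mul_of_gt h, q_pow_step]
  · rw [qInd_of_notMem (show simple i * w ∉ (μ.S : Set _) from fun h =>
      hw ((mul_mem_cancel_left hs).1 h)), qInd_of_notMem hw, mul_zero, mul_zero, add_zero]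

theorem m_mul_t (hr : 1 ≤ r) (σ : Equiv.Perm (Fin r)) (μ : RComp r n) (j : Fin n) :
    m σ μ * t j = root σ (μ.color j) • m σ μ := by
  rw [m_eq_comb, comb_mul hr, ← map_smul]
  congr 1
  funext w
  rw [rep_t, unop_diag_apply, Pi.mul_apply, Pi.smul_apply, smul_eq_mul]
  by_cases hw : w ∈ μ.S
  · rw [μ.mem_Sα.1 (μ.S_le_Sα hw)]
  · rw [qInd_of_notMem hw, mul_zero, mul_zero]

/-! ### Homomorphisms as images of the generator. -/

/-- Evaluation of homomorphisms at the generator `m_ν`. -/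
def evalGen (σ : Equiv.Perm (Fin r)) (ν μ : RComp r n) : HomM σ ν μ →ₗ[Base r] Y r n where
  toFun φ := (φ (mElt σ ν 1) : Y r n)
  map_add' _ _ := rfl
  map_smul' _ _ := rfl

theorem coe_apply_mElt (σ : Equiv.Perm (Fin r)) {ν μ : RComp r n} (φ : HomM σ ν μ) (h : Y r n) :
    (φ (mElt σ ν h) : Y r n) = evalGen σ ν μ φ * h := by
  have : mElt σ ν h = op h • mElt σ ν 1 := by
    apply Subtype.ext
    change m σ ν * h = m σ ν * 1 * h
    rw [mul_one]
  rw [this, map_smul]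
  rfl

theorem evalGen_injective (σ : Equiv.Perm (Fin r)) (ν μ : RComp r n) :
    Function.Injective (evalGen σ ν μ) := by
  intro φ ψ h
  refine LinearMap.ext ?_
  rintro ⟨_, k, rfl⟩
  apply Subtype.ext
  exact (coe_apply_mElt σ φ k).trans ((congrArg (· * k) h).trans (coe_apply_mElt σ ψ k).symm)

theorem evalGen_mul {σ : Equiv.Perm (Fin r)} {ν μ : RComp r n} (φ : HomM σ ν μ) {h : Y r n}
    {c : Base r} (hm : m σ ν * h = c • m σ ν) :
    evalGen σ ν μ φ * h = c • evalGen σ ν μ φ := by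
  have h1 : mElt σ ν h = mElt σ ν (algebraMap (Base r) (Y r n) c) := by
    apply Subtype.ext
    change m σ ν * h = m σ ν * algebraMap (Base r) (Y r n) c
    rw [hm, ← Algebra.commutes, Algebra.smul_def]
  rw [← coe_apply_mElt, h1, coe_apply_mElt, ← Algebra.commutes, Algebra.smul_def]

/-- Right eigenvector relations are inherited from the source by linearity; left ones come from the
target, because the image lies in `m σ μ` times the algebra. -/
theorem mul_evalGen {σ : Equiv.Perm (Fin r)} {ν μ : RComp r n} (φ : HomM σ ν μ) {h : Y r n}
    {c : Base r} (hm : h * m σ μ = c • m σ μ) :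
    h * evalGen σ ν μ φ = c • evalGen σ ν μ φ := by
  obtain ⟨k, hk⟩ := (φ (mElt σ ν 1)).2
  have hk' : evalGen σ ν μ φ = m σ μ * k := hk.symm
  rw [hk', ← mul_assoc, hm, smul_mul_assoc]

theorem exists_comb_eq_evalGen (hr : 1 ≤ r) {σ : Equiv.Perm (Fin r)} {ν μ : RComp r n}
    (φ : HomM σ ν μ) : ∃ F, comb σ μ F = evalGen σ ν μ φ := by
  obtain ⟨k, hk⟩ := (φ (mElt σ ν 1)).2
  obtain ⟨F, hF⟩ := exists_comb_eq hr σ μ (x μ * k)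
  exact ⟨F, hF.trans ((mul_assoc _ _ _).symm.trans hk)⟩

/-! ### Constraints on the coefficients of the image of `m_ν`. -/

section Coefficients

variable {σ : Equiv.Perm (Fin r)} {ν μ : RComp r n} {φ : HomM σ ν μ}
  {F : Equiv.Perm (Fin n) → Base r}

/-- The element `t j` acts on `U σ μ * gw r w` through the color of `w j` in `μ` and on the image of
`m σ ν` through the color of `j` in `ν`; distinct colors give distinct roots. -/
theorem color_of_coeff_ne_zero (hr : 1 ≤ r) (hF : comb σ μ F = evalGen σ ν μ φ)
    {w : Equiv.Perm (Fin n)} (hw : F w ≠ 0) (j : Fin n) : μ.color (w j) = ν.color j := by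
  have h := evalGen_mul φ (m_mul_t hr σ ν j)
  rw [← hF, comb_mul hr, ← map_smul] at h
  have := congrFun (comb_injective hr σ μ h) w
  rw [rep_t, unop_diag_apply, Pi.mul_apply, Pi.smul_apply, smul_eq_mul] at this
  exact root_injective hr σ (mul_right_cancel₀ hw this)

theorem qinv_pow_mul_congr {a b : Base r} {k : ℕ} (h : b = q r * a) :
    qinv r ^ (k + 1) * b = qinv r ^ k * a := by
  have := q_mul_qinv r
  rw [h, pow_succ]
  linear_combination qinv r ^ k * a * this

/-- Coefficients are compared only at the shorter of `w` and `w * simple i`, where the diagonal term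
is absent. -/
theorem coeff_mul_simple (hr : 1 ≤ r) (hF : comb σ μ F = evalGen σ ν μ φ) {i : Fin (n - 1)}
    (hi' : ν.row (lo i) = ν.row (hi i)) (w : Equiv.Perm (Fin n)) :
    qinv r ^ len (w * simple i) * F (w * simple i) = qinv r ^ len w * F w := by
  have h := evalGen_mul φ (m_mul_g hr σ ν hi')
  rw [← hF, comb_mul hr, ← map_smul] at h
  have key : ∀ w : Equiv.Perm (Fin n), w (lo i) < w (hi i) → F (w * simple i) = q r * F w := by
    intro w hw
    have := congrFun (comb_injective hr σ μ h) w
    rwa [rep_g, unop_op, opG_apply, diagCoeff, if_neg fun h' => h'.1.not_gt hw, zero_mul, add_zero,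
      Pi.smul_apply, smul_eq_mul] at this
  rcases lt_or_gt_of_ne (apply_lo_ne_apply_hi w i) with hw | hw
  · rw [len_mul_simple hw, qinv_pow_mul_congr (key w hw)]
  · have := key (w * simple i) (by simpa using hw)
    rw [mul_simple_mul_simple] at this
    rw [len_mul_simple_of_gt hw, qinv_pow_mul_congr this]

theorem coeff_simple_mul (hr : 1 ≤ r) (hF : comb σ μ F = evalGen σ ν μ φ) {i : Fin (n - 1)}
    (hi' : μ.row (lo i) = μ.row (hi i)) (w : Equiv.Perm (Fin n)) :
    qinv r ^ len (simple i * w) * F (simple i * w) = qinv r ^ len w * F w := by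
  have h := mul_evalGen φ (g_mul_m hr σ μ hi')
  rw [← hF, g_mul_comb hr σ μ (μ.color_eq_of_row_eq hi'), ← map_smul] at h
  have key : ∀ w : Equiv.Perm (Fin n), w⁻¹ (lo i) < w⁻¹ (hi i) →
      F (simple i * w) = q r * F w := by
    intro w hw
    have := congrFun (comb_injective hr σ μ h) w
    rwa [if_neg hw.not_gt, zero_mul, add_zero, Pi.smul_apply, smul_eq_mul] at this
  rcases lt_or_gt_of_ne (apply_lo_ne_apply_hi w⁻¹ i) with hw | hw
  · rw [len_simple_mul hw, qinv_pow_mul_congr (key w hw)]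
  · have := key (simple i * w) (by simpa using hw)
    rw [simple_mul_simple_mul] at this
    rw [len_simple_mul_of_gt hw, qinv_pow_mul_congr this]

theorem coeff_double_coset (hr : 1 ≤ r) (hF : comb σ μ F = evalGen σ ν μ φ)
    {a b : Equiv.Perm (Fin n)} (ha : a ∈ μ.S) (hb : b ∈ ν.S) (w : Equiv.Perm (Fin n)) :
    qinv r ^ len (a * w * b) * F (a * w * b) = qinv r ^ len w * F w := by
  rw [μ.S_eq] at ha
  rw [ν.S_eq] at hb
  have h1 : ∀ w, qinv r ^ len (a * w) * F (a * w) = qinv r ^ len w * F w := by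
    refine rowStab_induction μ.row_mono
      (P := fun a => ∀ w, qinv r ^ len (a * w) * F (a * w) = qinv r ^ len w * F w)
      (fun w => by rw [one_mul]) ?_ a ha
    intro a _ i hi' _ ih w
    rw [mul_assoc, ih, coeff_simple_mul hr hF hi']
  rw [← h1 w]
  refine rowStab_induction ν.row_mono
    (P := fun b => qinv r ^ len (a * w * b) * F (a * w * b) = qinv r ^ len (a * w) * F (a * w))
    (by rw [mul_one]) ?_ b hb
  intro b _ i hi' _ ih
  rw [← mul_assoc, coeff_mul_simple hr hF hi', ih]

end Coefficients

theorem hom_eq_zero_of_type_ne (hr : 1 ≤ r) (σ : Equiv.Perm (Fin r)) {μ ν : RComp r n}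
    (h : μ.type ≠ ν.type) (φ : HomM σ ν μ) : φ = 0 := by
  obtain ⟨F, hF⟩ := exists_comb_eq_evalGen hr φ
  have h0 : F = 0 := by
    funext w
    by_contra hw
    exact h (μ.type_eq_of_color ν w (color_of_coeff_ne_zero hr hF hw))
  apply evalGen_injective
  rw [← hF, h0, map_zero, map_zero]

/-! ### The homomorphisms attached to double cosets -/

open Classical in
/-- The sum of the `q^{l(w)} g_w` over the elements of `C` that are of minimal length in their
left coset of the row stabilizer of `ν`. -/
def leftFactor (ν : RComp r n) (C : Set (Equiv.Perm (Fin n))) : Y r n :=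
  ∑ d with d ∈ C ∧ RowInc ν.row d, q r ^ len d • gw r d

open Classical in
/-- The sum of the `q^{l(w)} g_w` over the elements of `C` that are of minimal length in their
right coset of the row stabilizer of `μ`. -/
def rightFactor (μ : RComp r n) (C : Set (Equiv.Perm (Fin n))) : Y r n :=
  ∑ d with d ∈ C ∧ RowInc μ.row d⁻¹, q r ^ len d • gw r d

open Classical in
theorem sum_eq_leftFactor_mul (ν : RComp r n) {C : Set (Equiv.Perm (Fin n))}
    (hC : ∀ w ∈ C, ∀ v ∈ ν.S, w * v ∈ C) :
    ∑ w with w ∈ C, q r ^ len w • gw r w = leftFactor ν C * x ν := by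
  rw [ν.S_eq] at hC
  rw [sum_eq_sum_rowInc_mul ν.row_mono C hC, leftFactor, x, Finset.sum_mul]
  refine Finset.sum_congr rfl fun d hd => ?_
  rw [Finset.mul_sum, ν.S_eq]
  refine Finset.sum_congr rfl fun v hv => ?_
  simp only [Finset.mem_filter, Finset.mem_univ, true_and] at hd hv
  have hl := len_mul_of_rowInc ν.row_mono hd.2 hv
  rw [gw_mul hl, hl, pow_add, smul_mul_smul_comm]

open Classical in
theorem sum_eq_mul_rightFactor (μ : RComp r n) {C : Set (Equiv.Perm (Fin n))}
    (hC : ∀ w ∈ C, ∀ v ∈ μ.S, v * w ∈ C) :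
    ∑ w with w ∈ C, q r ^ len w • gw r w = x μ * rightFactor μ C := by
  rw [μ.S_eq] at hC
  rw [sum_eq_sum_mul_rowInc μ.row_mono C hC, rightFactor, x, Finset.mul_sum]
  refine Finset.sum_congr rfl fun d hd => ?_
  rw [Finset.sum_mul, μ.S_eq]
  refine Finset.sum_congr rfl fun v hv => ?_
  simp only [Finset.mem_filter, Finset.mem_univ, true_and] at hd hv
  have hl := len_mul_of_rowInc_inv μ.row_mono hd.2 hv
  rw [gw_mul hl, hl, pow_add, smul_mul_smul_comm]

theorem comb_qInd_eq_mul_rightFactor (σ : Equiv.Perm (Fin r)) (μ : RComp r n)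
    {C : Set (Equiv.Perm (Fin n))} (hC : ∀ w ∈ C, ∀ v ∈ μ.S, v * w ∈ C) :
    comb σ μ (qInd r C) = m σ μ * rightFactor μ C := by
  classical
  rw [comb_qInd, m, mul_assoc, ← sum_eq_mul_rightFactor μ hC, Finset.mul_sum]
  simp only [mul_smul_comm]

/-- Equality of types turns `U σ μ` into `U σ ν`, and `C` lying in `μ.Sα` lets it pass the left
factor. Together with `comb_qInd_eq_mul_rightFactor`, this makes left multiplication map `M σ ν`
into `M σ μ`. -/
theorem comb_qInd_eq_leftFactor_mul (hr : 1 ≤ r) (σ : Equiv.Perm (Fin r)) {μ ν : RComp r n}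
    (h : μ.type = ν.type) {C : Set (Equiv.Perm (Fin n))} (hC : ∀ w ∈ C, ∀ v ∈ ν.S, w * v ∈ C)
    (hC' : ∀ w ∈ C, w ∈ μ.Sα) :
    comb σ μ (qInd r C) = leftFactor ν C * m σ ν := by
  classical
  have hU : leftFactor ν C * U σ μ = U σ μ * leftFactor ν C := by
    rw [leftFactor, Finset.sum_mul, Finset.mul_sum]
    refine Finset.sum_congr rfl fun d hd => ?_
    simp only [Finset.mem_filter, Finset.mem_univ, true_and] at hd
    rw [smul_mul_assoc, gw_mul_U hr σ μ (hC' d hd.1), mul_smul_comm]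
  rw [m, ← mul_assoc, ← U_congr σ h, hU, mul_assoc, ← sum_eq_leftFactor_mul ν hC, comb_qInd,
    Finset.mul_sum]
  simp only [mul_smul_comm]

/-- The double coset `𝔖_μ d 𝔖_ν`. -/
abbrev dcoset (μ ν : RComp r n) (d : Equiv.Perm (Fin n)) : Set (Equiv.Perm (Fin n)) :=
  DoubleCoset.doubleCoset d (μ.S : Set (Equiv.Perm (Fin n))) (ν.S : Set (Equiv.Perm (Fin n)))

theorem mem_dcoset {μ ν : RComp r n} {d w : Equiv.Perm (Fin n)} :
    w ∈ dcoset μ ν d ↔ ∃ a ∈ μ.S, ∃ b ∈ ν.S, w = a * d * b :=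
  DoubleCoset.mem_doubleCoset

theorem mul_mem_dcoset {μ ν : RComp r n} {d w v : Equiv.Perm (Fin n)} (hw : w ∈ dcoset μ ν d)
    (hv : v ∈ ν.S) : w * v ∈ dcoset μ ν d := by
  obtain ⟨a, ha, b, hb, rfl⟩ := mem_dcoset.1 hw
  exact mem_dcoset.2 ⟨a, ha, b * v, mul_mem hb hv, by simp only [mul_assoc]⟩

theorem mul_mem_dcoset' {μ ν : RComp r n} {d w v : Equiv.Perm (Fin n)} (hw : w ∈ dcoset μ ν d)
    (hv : v ∈ μ.S) : v * w ∈ dcoset μ ν d := by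
  obtain ⟨a, ha, b, hb, rfl⟩ := mem_dcoset.1 hw
  exact mem_dcoset.2 ⟨v * a, mul_mem hv ha, b, hb, by simp only [mul_assoc]⟩

theorem Sα_congr {μ ν : RComp r n} (h : μ.type = ν.type) : μ.Sα = ν.Sα := by
  rw [RComp.Sα, RComp.Sα, RComp.typeList_congr h]

theorem mem_Sα_of_mem_dcoset {μ ν : RComp r n} (h : μ.type = ν.type) {d w : Equiv.Perm (Fin n)}
    (hd : d ∈ μ.Sα) (hw : w ∈ dcoset μ ν d) : w ∈ μ.Sα := by
  obtain ⟨a, ha, b, hb, rfl⟩ := mem_dcoset.1 hw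
  exact mul_mem (mul_mem (μ.S_le_Sα ha) hd) (Sα_congr h ▸ ν.S_le_Sα hb)

/-- The homomorphism `φ_{μν}^d`. -/
def dcosetHom (hr : 1 ≤ r) (σ : Equiv.Perm (Fin r)) {μ ν : RComp r n} (h : μ.type = ν.type)
    {d : Equiv.Perm (Fin n)} (hd : d ∈ μ.Sα) : HomM σ ν μ where
  toFun z := ⟨leftFactor ν (dcoset μ ν d) * z, by
    obtain ⟨_, k, rfl⟩ := z
    -- The double coset sum equals both `leftFactor * m σ ν` and `m σ μ * rightFactor`, which
    -- supplies the witness.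
    refine ⟨rightFactor μ (dcoset μ ν d) * k, ?_⟩
    change m σ μ * _ = leftFactor ν (dcoset μ ν d) * (m σ ν * k)
    rw [← mul_assoc, ← mul_assoc, ← comb_qInd_eq_mul_rightFactor σ μ fun _ hw _ hv =>
      mul_mem_dcoset' hw hv, comb_qInd_eq_leftFactor_mul hr σ h
      (fun _ hw _ hv => mul_mem_dcoset hw hv) fun _ hw => mem_Sα_of_mem_dcoset h hd hw]⟩
  map_add' z z' := Subtype.ext (mul_add _ _ _)
  map_smul' c z := Subtype.ext (mul_assoc _ _ _).symm

theorem evalGen_dcosetHom (hr : 1 ≤ r) (σ : Equiv.Perm (Fin r)) {μ ν : RComp r n}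
    (h : μ.type = ν.type) {d : Equiv.Perm (Fin n)} (hd : d ∈ μ.Sα) :
    evalGen σ ν μ (dcosetHom hr σ h hd) = comb σ μ (qInd r (dcoset μ ν d)) := by
  rw [comb_qInd_eq_leftFactor_mul hr σ h (fun _ hw _ hv => mul_mem_dcoset hw hv)
    fun _ hw => mem_Sα_of_mem_dcoset h hd hw]
  change leftFactor ν (dcoset μ ν d) * (m σ ν * 1) = _
  rw [mul_one]

theorem isPhi_dcosetHom (hr : 1 ≤ r) (σ : Equiv.Perm (Fin r)) {μ ν : RComp r n}
    (h : μ.type = ν.type) {d : Equiv.Perm (Fin n)} (hd : d ∈ μ.Sα) :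
    IsPhi σ μ ν d (dcosetHom hr σ h hd) := by
  intro k
  rw [coe_apply_mElt, evalGen_dcosetHom, comb_qInd, Finset.sum_mul]
  simp only [smul_mul_assoc]

/-! ### The basis of the space of homomorphisms -/

theorem mem_dcoset_iff_eq {μ ν : RComp r n} {d d' : Equiv.Perm (Fin n)} (hd : d ∈ RComp.DD μ ν)
    (hd' : d' ∈ RComp.DD μ ν) : d' ∈ dcoset μ ν d ↔ d' = d := by
  refine ⟨fun h => ?_, fun h => mem_dcoset.2 ⟨1, one_mem _, 1, one_mem _, by simp [h]⟩⟩
  obtain ⟨a, ha, b, hb, he⟩ := mem_dcoset.1 h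
  rw [μ.S_eq] at ha
  rw [ν.S_eq] at hb
  refine eq_of_rowInc μ.row_mono ha hb (μ.mem_D_iff.1 hd.1) ?_ (μ.mem_D_iff.1 hd'.1) ?_ he
  · simpa using ν.mem_D_iff.1 hd.2
  · simpa using ν.mem_D_iff.1 hd'.2

theorem exists_mem_DD (μ ν : RComp r n) (w : Equiv.Perm (Fin n)) :
    ∃ d ∈ RComp.DD μ ν, ∃ a ∈ μ.S, ∃ b ∈ ν.S, d = a * w * b := by
  obtain ⟨a, ha, b, hb, h1, h2⟩ := exists_rowInc μ.row_mono ν.row_mono w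
  rw [← μ.S_eq] at ha
  rw [← ν.S_eq] at hb
  exact ⟨a * w * b, ⟨μ.mem_D_iff.2 h1, ν.mem_D_iff.2 (by simpa using h2)⟩, a, ha, b, hb, rfl⟩

theorem mem_dcoset_of_eq {μ ν : RComp r n} {d w a b : Equiv.Perm (Fin n)} (ha : a ∈ μ.S)
    (hb : b ∈ ν.S) (h : d = a * w * b) : w ∈ dcoset μ ν d :=
  mem_dcoset.2 ⟨a⁻¹, inv_mem ha, b⁻¹, inv_mem hb, by rw [h]; group⟩

theorem qInd_dcoset_eq_zero {μ ν : RComp r n} {d d' w : Equiv.Perm (Fin n)}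
    (hd : d ∈ RComp.DD μ ν) (hd' : d' ∈ RComp.DD μ ν) (hne : d' ≠ d) (hw : w ∈ dcoset μ ν d) :
    qInd r (dcoset μ ν d') w = 0 := by
  refine qInd_of_notMem fun hw' => hne ((mem_dcoset_iff_eq hd hd').1 ?_)
  obtain ⟨a, ha, b, hb, h⟩ := mem_dcoset.1 hw'
  have : d' = a⁻¹ * w * b⁻¹ := by rw [h]; group
  rw [this]
  exact mul_mem_dcoset (mul_mem_dcoset' hw (inv_mem ha)) (inv_mem hb)

/-- Double cosets of distinct representatives are disjoint, so the coefficient at `d` sees only the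
term of `d`, multiplied by a power of `q`. -/
theorem linearIndependent_dcosetHom (hr : 1 ≤ r) (σ : Equiv.Perm (Fin r)) {μ ν : RComp r n}
    (h : μ.type = ν.type) :
    LinearIndependent (Base r)
      fun d : {d : Equiv.Perm (Fin n) // d ∈ RComp.DD μ ν ∧ d ∈ μ.Sα} =>
        dcosetHom hr σ h d.2.2 := by
  classical
  rw [Fintype.linearIndependent_iffₛ]
  intro c c' hc d
  have h1 := congrArg (evalGen σ ν μ) hc
  simp only [map_sum, map_smul, evalGen_dcosetHom] at h1
  simp only [← map_smul, ← map_sum] at h1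
  have hmem : d.1 ∈ dcoset μ ν d.1 := (mem_dcoset_iff_eq d.2.1 d.2.1).2 rfl
  have key : ∀ c : {d : Equiv.Perm (Fin n) // d ∈ RComp.DD μ ν ∧ d ∈ μ.Sα} → Base r,
      (∑ d', c d' • qInd r (dcoset μ ν d'.1)) d.1 = c d * q r ^ len d.1 := by
    intro c
    rw [Finset.sum_apply, Finset.sum_eq_single d, Pi.smul_apply, qInd_of_mem hmem, smul_eq_mul]
    · intro d' _ hne
      rw [Pi.smul_apply, qInd_dcoset_eq_zero d.2.1 d'.2.1 (fun h => hne (Subtype.ext h)) hmem,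
        smul_zero]
    · simp
  have h2 := congrFun (comb_injective hr σ μ h1) d.1
  rw [key, key] at h2
  exact mul_right_cancel₀ (pow_ne_zero _ (q_ne_zero r)) h2

theorem span_dcosetHom (hr : 1 ≤ r) (σ : Equiv.Perm (Fin r)) {μ ν : RComp r n}
    (h : μ.type = ν.type) :
    ⊤ ≤ Submodule.span (Base r) (Set.range
      fun d : {d : Equiv.Perm (Fin n) // d ∈ RComp.DD μ ν ∧ d ∈ μ.Sα} =>
        dcosetHom hr σ h d.2.2) := by
  classical
  intro φ _
  obtain ⟨F, hF⟩ := exists_comb_eq_evalGen hr φ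
  -- The coefficient is the constant value of `q^{-l(w)} F(w)` on the double coset, read off at `d`.
  suffices hφ : φ = ∑ d : {d : Equiv.Perm (Fin n) // d ∈ RComp.DD μ ν ∧ d ∈ μ.Sα},
      (qinv r ^ len d.1 * F d.1) • dcosetHom hr σ h d.2.2 by
    rw [hφ]
    exact Submodule.sum_mem _ fun d _ => Submodule.smul_mem _ _ (Submodule.subset_span ⟨d, rfl⟩)
  apply evalGen_injective
  simp only [map_sum, map_smul, evalGen_dcosetHom]
  simp only [← map_smul, ← map_sum]
  rw [← hF]
  congr 1
  funext w
  rw [Finset.sum_apply]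
  by_cases hw : w ∈ μ.Sα
  · obtain ⟨d, hd, a, ha, b, hb, hab⟩ := exists_mem_DD μ ν w
    have hd' : d ∈ μ.Sα := by
      rw [hab]
      exact mul_mem (mul_mem (μ.S_le_Sα ha) hw) (Sα_congr h ▸ ν.S_le_Sα hb)
    have hwd := mem_dcoset_of_eq ha hb hab
    rw [Finset.sum_eq_single ⟨d, hd, hd'⟩, Pi.smul_apply, qInd_of_mem hwd, smul_eq_mul]
    · simp only
      rw [hab, coeff_double_coset hr hF ha hb, mul_right_comm, mul_comm (qinv r ^ _),
        q_pow_mul_qinv_pow, one_mul]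
    · intro d' _ hne
      rw [Pi.smul_apply, qInd_dcoset_eq_zero hd d'.2.1 (fun h => hne (Subtype.ext h)) hwd,
        smul_zero]
    · simp
  -- Outside `μ.Sα` both sides vanish: `F` by its weight, and the double coset sums because each of
  -- these cosets lies in `μ.Sα`.
  · have h0 : F w = 0 := by
      by_contra hne
      refine hw (μ.mem_Sα.2 fun j => ?_)
      rw [color_of_coeff_ne_zero hr hF hne, RComp.color_congr h]
    rw [h0, Finset.sum_eq_zero]
    intro d _
    rw [Pi.smul_apply, qInd_of_notMem (fun h' => hw (mem_Sα_of_mem_dcoset h d.2.2 h')), smul_zero]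

end Homs

end YokonumaSchur

end

open YokonumaSchur in
theorem proposition3p4 (r n : ℕ) (hr : 1 ≤ r) (σ : Equiv.Perm (Fin r)) (μ ν : RComp r n) :
    (μ.type ≠ ν.type → ∀ φ : HomM σ ν μ, φ = 0) ∧
    (μ.type = ν.type →
      ∃ b : Module.Basis {d : Equiv.Perm (Fin n) // d ∈ RComp.DD μ ν ∧ d ∈ μ.Sα}
          (Base r) (HomM σ ν μ),
        ∀ d, IsPhi σ μ ν d.1 (b d)) := by
  refine ⟨fun h => hom_eq_zero_of_type_ne hr σ h, fun h =>
    ⟨Module.Basis.mk (linearIndependent_dcosetHom hr σ h) (span_dcosetHom hr σ h), fun d => ?_⟩⟩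
  rw [Module.Basis.mk_apply]
  exact isPhi_dcosetHom hr σ h d.2.2
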